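/- **Proposition 3.2.** Graphs are undirected, possibly infinite, without multiple edges, and may have loops: a graph $G$ is a set $V(G)$ with a symmetric subset $E(G)\subset V(G)\times V(G)$, and we write $\langle x,y\rangle=\{(x,y),(y,x)\}$. A graph homomorphism is a map of vertices sending edges to edges. The box complex $B(G)=\mathrm{Hom}(K_2,G)$ is the poset of pairs $(\sigma,\tau)$ of nonempty subsets of $V(G)$ with $\sigma\times\tau\subset E(G)$, ordered by componentwise inclusion; a homomorphism $f:G\to H$ induces the order-preserving map $f_*:B(G)\to B(H)$, $(\sigma,\tau)\mapsto(f(\sigma),f(\tau))$. For a poset $P$, $|P|$ denotes the geometric realization of its order complex (the simplicial complex of finite chains of $P$) with the weak topology, and $|f|:|P|\to|Q|$ denotes the map induced by an order-preserving map $f:P\to Q$. Let $G$ be a graph and $e=\langle v,w\rangle$ an edge of $G$, where $v$ and $w$ are not both looped, that is, $(v,v)$ and $(w,w)$ do not both belong to $E(G)$ (in particular $v\ne w$). Let $G\setminus e$ be the graph with vertex set $V(G)$ and edge set $E(G)\setminus e$, and let $L_3$ be the path with vertices $0,1,2,3$ in which $a$ and $b$ are adjacent if and only if $|a-b|=1$.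 Let $G_e$ be the graph with vertex set $V(G)\sqcup\{0,1\}$ and edge set $$E(G_e)=(E(G)\setminus e)\cup\langle 0,1\rangle\cup\langle 0,v\rangle\cup\langle 1,w\rangle,$$ and let $r_e:G_e\to G$ be the homomorphism that is the identity on $V(G)$ and sends $0\mapsto w$, $1\mapsto v$. Suppose that there is no graph homomorphism $L_3\to G\setminus e$ sending $0$ to $v$ and $3$ to $w$. Then $|r_{e*}|:|B(G_e)|\to|B(G)|$ is a homotopy equivalence. Moreover, $|B(G)|$ is obtained from $|B(G_e)|$ by collapsing two disjoint intervals to two points, respectively: there are disjoint subspaces $I,J\subset|B(G_e)|$, each homeomorphic to $[0,1]$, such that $|r_{e*}|$ induces a homeomorphism from the quotient space of $|B(G_e)|$, in which $I$ is collapsed to one point and $J$ to another point, onto $|B(G)|$. -/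

import Mathlib

/-! ### Graphs (undirected, loops allowed, no multiple edges) -/

/-- A graph on the vertex set `V`: a symmetric subset of `V × V`, given as a relation. Loops are
allowed. -/
@[ext]
structure LoopGraph (V : Type*) where
  /-- `Adj x y` means that `(x, y)` is in the edge set. -/
  Adj : V → V → Prop
  symm : ∀ {x y : V}, Adj x y → Adj y x

namespace LoopGraph

/-- Graph homomorphisms: maps of vertices that send edges to edges. -/
abbrev Hom {V W : Type*} (G : LoopGraph V) (H : LoopGraph W) : Type _ :=
  G.Adj →r H.Adj

/-- The relation `⟨a, b⟩ = {(a, b), (b, a)}`. -/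
def Pair {V : Type*} (a b : V) (x y : V) : Prop :=
  (x = a ∧ y = b) ∨ (x = b ∧ y = a)

theorem Pair.symm {V : Type*} {a b x y : V} (h : Pair a b x y) : Pair a b y x := by
  unfold Pair at *
  tauto

/-- The graph `G ∖ e` for `e = ⟨v, w⟩`: same vertices, the edge `e` removed. -/
def deleteEdge {V : Type*} (G : LoopGraph V) (v w : V) : LoopGraph V where
  Adj x y := G.Adj x y ∧ ¬ Pair v w x y
  symm h := ⟨G.symm h.1, fun h' => h.2 h'.symm⟩

/-- The complete graph `K_n` without loops. -/
def complete (n : ℕ) : LoopGraph (Fin n) where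
  Adj x y := x ≠ y
  symm h := h.symm

/-- The path `L_n` with vertices `0, 1, …, n`, where `a` and `b` are adjacent iff `|a - b| = 1`. -/
def path (n : ℕ) : LoopGraph (Fin (n + 1)) where
  Adj a b := |((a : ℕ) : ℤ) - ((b : ℕ) : ℤ)| = 1
  symm h := by rw [abs_sub_comm]; exact h

/-- The graph `G_e` for `e = ⟨v, w⟩`. Its vertex set is the disjoint union of `V` and `{0, 1}`, its
edge set is `(E(G) ∖ e) ∪ ⟨0, 1⟩ ∪ ⟨0, v⟩ ∪ ⟨1, w⟩`. -/
def subdivide {V : Type*} (G : LoopGraph V) (v w : V) : LoopGraph (V ⊕ Fin 2) where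
  Adj x y :=
    (∃ a b : V, x = Sum.inl a ∧ y = Sum.inl b ∧ (G.deleteEdge v w).Adj a b) ∨
    Pair (Sum.inr 0) (Sum.inr 1) x y ∨
    Pair (Sum.inr 0) (Sum.inl v) x y ∨
    Pair (Sum.inr 1) (Sum.inl w) x y
  symm := by
    rintro x y (⟨a, b, rfl, rfl, h⟩ | h | h | h)
    · exact Or.inl ⟨b, a, rfl, rfl, (G.deleteEdge v w).symm h⟩
    · exact Or.inr (Or.inl h.symm)
    · exact Or.inr (Or.inr (Or.inl h.symm))
    · exact Or.inr (Or.inr (Or.inr h.symm))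

/-- The homomorphism `r_e : G_e → G`: the identity on `V`, and `0 ↦ w`, `1 ↦ v`. -/
def retract {V : Type*} (G : LoopGraph V) (v w : V) (hvw : G.Adj v w) :
    Hom (G.subdivide v w) G where
  toFun := Sum.elim id ![w, v]
  map_rel' := by
    have hwv := G.symm hvw
    rintro x y (⟨a, b, rfl, rfl, h⟩ | (⟨rfl, rfl⟩ | ⟨rfl, rfl⟩) | (⟨rfl, rfl⟩ | ⟨rfl, rfl⟩) |
      (⟨rfl, rfl⟩ | ⟨rfl, rfl⟩))
    · exact h.1
    all_goals simpa

/-! ### Hom complexes and box complexes -/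

/-- The Hom complex `Hom(G, H)`: the poset of multi-homomorphisms from `G` to `H`, that is, of maps
`η` from vertices of `G` to nonempty sets of vertices of `H` with `η x × η y ⊆ E(H)` for every edge
`(x, y)` of `G`, ordered by pointwise inclusion. -/
abbrev HomComplex {V W : Type*} (G : LoopGraph V) (H : LoopGraph W) : Type _ :=
  {η : V → Set W //
    (∀ x, (η x).Nonempty) ∧
    ∀ x y, G.Adj x y → ∀ a ∈ η x, ∀ b ∈ η y, H.Adj a b}

/-- The order-preserving map `g_* : Hom(T, G) → Hom(T, H)` induced by `g : G → H`,
`g_*(η)(x) = g(η(x))`. -/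
def HomComplex.map {U V W : Type*} (T : LoopGraph U) {G : LoopGraph V} {H : LoopGraph W}
    (g : Hom G H) : HomComplex T G →o HomComplex T H where
  toFun η := ⟨fun x => g '' η.1 x, fun x => (η.2.1 x).image _, by
    rintro x y hxy _ ⟨a, ha, rfl⟩ _ ⟨b, hb, rfl⟩
    exact g.map_rel (η.2.2 x y hxy a ha b hb)⟩
  monotone' _ _ h x := Set.image_mono (h x)

/-- The box complex `B(G) = Hom(K_2, G)`. -/
abbrev Box {V : Type*} (G : LoopGraph V) : Type _ :=
  HomComplex (complete 2) G

/-- The map `B(G) → B(H)` induced by a homomorphism `G → H`. -/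
abbrev Box.map {V W : Type*} {G : LoopGraph V} {H : LoopGraph W} (g : Hom G H) :
    Box G →o Box H :=
  HomComplex.map (complete 2) g

end LoopGraph

/-! ### The classifying space of a poset -/

/-- The classifying space `|P|` of a poset `P`, that is, the geometric realization of its order
complex: finitely supported barycentric coordinates on `P` whose support is a chain. -/
def ClassifyingSpace (P : Type*) [PartialOrder P] : Type _ :=
  {x : P →₀ ℝ //
    (∀ p, 0 ≤ x p) ∧ (x.sum fun _ t => t) = 1 ∧ IsChain (· ≤ ·) (x.support : Set P)}

namespace ClassifyingSpace

theorem mapDomain_mem {ι P : Type*} [PartialOrder P] (f : ι → P) (x : ι →₀ ℝ)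
    (h0 : ∀ i, 0 ≤ x i) (h1 : (x.sum fun _ t => t) = 1)
    (hc : IsChain (· ≤ ·) (f '' (x.support : Set ι))) :
    (∀ p, 0 ≤ Finsupp.mapDomain f x p) ∧
      ((Finsupp.mapDomain f x).sum fun _ t => t) = 1 ∧
      IsChain (· ≤ ·) ((Finsupp.mapDomain f x).support : Set P) := by
  classical
  refine ⟨fun p => ?_, ?_, hc.mono ?_⟩
  · rw [Finsupp.mapDomain, Finsupp.sum_apply, Finsupp.sum]
    refine Finset.sum_nonneg fun i _ => ?_
    rw [Finsupp.single_apply]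
    split_ifs
    exacts [h0 i, le_rfl]
  · rw [Finsupp.sum_mapDomain_index (fun _ => rfl) (fun _ _ _ => rfl), h1]
  · intro p hp
    have := Finsupp.mapDomain_support hp
    simpa using this

/-- The inclusion of the closed simplex spanned by a finite chain `s` of `P` into `|P|`. -/
noncomputable def simplexInclusion {P : Type*} [PartialOrder P] (s : Finset P)
    (hs : IsChain (· ≤ ·) (s : Set P)) (x : stdSimplex ℝ s) : ClassifyingSpace P :=
  ⟨Finsupp.mapDomain Subtype.val (Finsupp.equivFunOnFinite.symm x.1),
    mapDomain_mem _ _ (fun i => x.2.1 i)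
      (by
        rw [Finsupp.sum_fintype _ _ (fun _ => rfl)]
        exact x.2.2)
      (hs.mono (by rintro _ ⟨i, -, rfl⟩; exact i.2))⟩

/-- The weak (direct limit) topology: a subset of `|P|` is open if and only if its intersection with
each closed simplex is open in that simplex. -/
noncomputable instance {P : Type*} [PartialOrder P] : TopologicalSpace (ClassifyingSpace P) :=
  ⨆ s : {s : Finset P // IsChain (· ≤ ·) (s : Set P)},
    TopologicalSpace.coinduced (simplexInclusion s.1 s.2) inferInstance

theorem continuous_simplexInclusion {P : Type*} [PartialOrder P] (s : Finset P)
    (hs : IsChain (· ≤ ·) (s : Set P)) : Continuous (simplexInclusion s hs) := by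
  rw [continuous_iff_coinduced_le]
  exact le_iSup (fun s : {s : Finset P // IsChain (· ≤ ·) (s : Set P)} =>
    TopologicalSpace.coinduced (simplexInclusion s.1 s.2) inferInstance) ⟨s, hs⟩

/-- The underlying function of `|f| : |P| → |Q|`: affine on each simplex, `p ↦ f p` on vertices. -/
noncomputable def mapFun {P Q : Type*} [PartialOrder P] [PartialOrder Q] (f : P →o Q)
    (x : ClassifyingSpace P) : ClassifyingSpace Q :=
  ⟨Finsupp.mapDomain f x.1, mapDomain_mem _ _ x.2.1 x.2.2.1 (by
    rintro _ ⟨a, ha, rfl⟩ _ ⟨b, hb, rfl⟩ -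
    rcases x.2.2.2.total ha hb with h | h
    exacts [Or.inl (f.monotone h), Or.inr (f.monotone h)])⟩

theorem continuous_mapFun {P Q : Type*} [PartialOrder P] [PartialOrder Q] (f : P →o Q) :
    Continuous (mapFun f) := by
  classical
  refine continuous_iSup_dom.2 fun ⟨s, hs⟩ => continuous_coinduced_dom.2 ?_
  have ht : IsChain (· ≤ ·) ((s.image f : Finset Q) : Set Q) := by
    rw [Finset.coe_image]
    rintro _ ⟨a, ha, rfl⟩ _ ⟨b, hb, rfl⟩ -
    rcases hs.total ha hb with h | h
    exacts [Or.inl (f.monotone h), Or.inr (f.monotone h)]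
  let f' : s → (s.image f : Finset Q) := fun p => ⟨f p.1, Finset.mem_image_of_mem f p.2⟩
  have key : mapFun f ∘ simplexInclusion s hs =
      simplexInclusion (s.image f) ht ∘ stdSimplex.map f' := by
    funext x
    apply Subtype.ext
    change Finsupp.mapDomain f (Finsupp.mapDomain Subtype.val _) =
      Finsupp.mapDomain Subtype.val (Finsupp.equivFunOnFinite.symm (stdSimplex.map f' x).1)
    have h2 : Finsupp.equivFunOnFinite.symm (stdSimplex.map f' x).1 =
        Finsupp.mapDomain f' (Finsupp.equivFunOnFinite.symm x.1) := by
      apply Finsupp.equivFunOnFinite.injective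
      rw [Equiv.apply_symm_apply]
      rfl
    rw [h2, ← Finsupp.mapDomain_comp, ← Finsupp.mapDomain_comp]
    rfl
  rw [key]
  exact (continuous_simplexInclusion _ ht).comp (stdSimplex.continuous_map f')

/-- The continuous map `|f| : |P| → |Q|` induced by an order-preserving map `f : P → Q`. -/
noncomputable def map {P Q : Type*} [PartialOrder P] [PartialOrder Q] (f : P →o Q) :
    C(ClassifyingSpace P, ClassifyingSpace Q) :=
  ⟨mapFun f, continuous_mapFun f⟩

end ClassifyingSpace

/-! ### Collapsing two subspaces -/

/-- The quotient space of `X` in which `A` is collapsed to a point and `B` is collapsed to a point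
(for disjoint `A` and `B` these are two different points), with the quotient topology. -/
abbrev CollapseTwo {X : Type*} (A B : Set X) : Type _ :=
  Quot fun x y : X => (x ∈ A ∧ y ∈ A) ∨ (x ∈ B ∧ y ∈ B)

/-- A continuous map is a homotopy equivalence. -/
def IsHomotopyEquivalence {X Y : Type*} [TopologicalSpace X] [TopologicalSpace Y]
    (f : C(X, Y)) : Prop :=
  ∃ E : ContinuousMap.HomotopyEquiv X Y, E.toFun = f

/-! ### Points and maps of classifying spaces in coordinates -/

namespace ClassifyingSpace

open Topology unitInterval

section Coordinates

variable {P Q : Type*} [PartialOrder P] [PartialOrder Q]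

/-! Let z₀, z₁ be the two orientations of ({w}, {v}) in B(G); both are minimal. The fibre of the
poset map over each is a fence ({0}, {v}) < ({0}, {1, v}) > ({0}, {1}) < ({0, w}, {1}) > ({w}, {1}),
up to orientation, so its realization is an arc. An element strictly above zᵢ has a single preimage,
which lies above exactly one end of the fence and above none of its three inner elements. Away from
the two fences the map reflects the order. The hypotheses on loops and paths serve surjectivity: if
w ∈ σ and v ∈ τ, then σ = {w} or τ = {v}, since otherwise some v, a, b, w would be a path in G ∖ e;
hence one end of e can be replaced by a new vertex to lift (σ, τ). `IsZigzagCollapse` records these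
facts.

For any such f : P → Q, the map |f| is injective off the two arcs (`map_eq_map`), and every finite
chain of Q lifts to P (`exists_chain_section`), so |f| is a quotient map. This gives the
homeomorphism. For the homotopy equivalence, each arc is contracted by four explicit deformations of
|P|, each collapsing one edge (`push`). They send fibres of |f| into fibres, so the resulting
homotopy descends to |Q| (`IsFibrewiseDeformation.isHomotopyEquivalence`). -/

theorem ext_coord {x y : ClassifyingSpace P} (h : ∀ p, x.1 p = y.1 p) : x = y :=
  Subtype.ext (Finsupp.ext h)

theorem coord_nonneg (x : ClassifyingSpace P) (p : P) : 0 ≤ x.1 p :=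
  x.2.1 p

theorem degree_eq_one (x : ClassifyingSpace P) : x.1.degree = 1 :=
  x.2.2.1

theorem comparable (x : ClassifyingSpace P) {a b : P} (ha : x.1 a ≠ 0) (hb : x.1 b ≠ 0) :
    a ≤ b ∨ b ≤ a :=
  x.2.2.2.total (Finsupp.mem_support_iff.2 ha) (Finsupp.mem_support_iff.2 hb)

theorem exists_coord_ne_zero (x : ClassifyingSpace P) : ∃ p, x.1 p ≠ 0 := by
  by_contra! h
  have h0 : x.1 = 0 := Finsupp.ext h
  simpa [h0] using x.degree_eq_one

theorem sum_coord_of_subset (x : ClassifyingSpace P) (s : Finset P)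
    (hs : ∀ p ∉ s, x.1 p = 0) : ∑ p ∈ s, x.1 p = 1 := by
  refine Eq.trans (Finset.sum_subset (fun p hp => ?_) fun p _ hp => ?_).symm x.degree_eq_one
  · by_contra h
    exact Finsupp.mem_support_iff.1 hp (hs p h)
  · simpa using hp

theorem sum_coord_le_one (x : ClassifyingSpace P) (s : Finset P) : ∑ p ∈ s, x.1 p ≤ 1 := by
  classical
  refine (Finset.sum_le_sum_of_subset_of_nonneg Finset.subset_union_left
    fun p _ _ => x.2.1 p).trans_eq (x.sum_coord_of_subset (s ∪ x.1.support) fun p hp => ?_)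
  simpa using (Finset.notMem_union.1 hp).2

theorem coord_add_coord_le_one (x : ClassifyingSpace P) {a b : P} (hab : a ≠ b) :
    x.1 a + x.1 b ≤ 1 := by
  classical
  simpa [Finset.sum_pair hab] using x.sum_coord_le_one {a, b}

theorem simplexInclusion_coord (s : Finset P) (hs : IsChain (· ≤ ·) (s : Set P))
    (x : stdSimplex ℝ s) (p : s) : (simplexInclusion s hs x).1 p = x p :=
  Finsupp.mapDomain_apply Subtype.val_injective _ p

theorem simplexInclusion_coord_of_notMem (s : Finset P) (hs : IsChain (· ≤ ·) (s : Set P))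
    (x : stdSimplex ℝ s) {p : P} (hp : p ∉ s) : (simplexInclusion s hs x).1 p = 0 :=
  Finsupp.mapDomain_of_notMem_range _ _ (by simpa using hp)

theorem exists_simplexInclusion_eq (x : ClassifyingSpace P) (s : Finset P)
    (hs : IsChain (· ≤ ·) (s : Set P)) (h : ∀ p ∉ s, x.1 p = 0) :
    ∃ y : stdSimplex ℝ s, (∀ p : s, y p = x.1 p) ∧ simplexInclusion s hs y = x := by
  refine ⟨⟨fun p => x.1 p, fun p => x.2.1 p, ?_⟩, fun p => rfl, ext_coord fun p => ?_⟩
  · exact (Finset.sum_coe_sort s fun p => x.1 p).trans (x.sum_coord_of_subset s h)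
  · by_cases hp : p ∈ s
    · exact simplexInclusion_coord s hs _ ⟨p, hp⟩
    · rw [simplexInclusion_coord_of_notMem s hs _ hp, h p hp]

/-- A map into `|P|` whose values lie in one closed simplex is continuous as soon as its
barycentric coordinates are. -/
theorem continuous_of_support_subset {Z : Type*} [TopologicalSpace Z] {g : Z → ClassifyingSpace P}
    (s : Finset P) (hs : IsChain (· ≤ ·) (s : Set P)) (h0 : ∀ z, ∀ p ∉ s, (g z).1 p = 0)
    (hc : ∀ p, Continuous fun z => (g z).1 p) : Continuous g := by
  choose y hy hyg using fun z => exists_simplexInclusion_eq (g z) s hs (h0 z)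
  have hyc : Continuous y := by
    refine Continuous.subtype_mk (f := fun z => (y z).1) ?_ _
    refine continuous_pi fun p => ?_
    have : (fun z => (y z).1 p) = fun z => (g z).1 p := funext fun z => hy z p
    rw [this]
    exact hc p
  rw [← funext hyg]
  exact (continuous_simplexInclusion s hs).comp hyc

theorem continuousOn_of_support_subset {Z : Type*} [TopologicalSpace Z]
    {g : Z → ClassifyingSpace P} {A : Set Z}
    (s : Finset P) (hs : IsChain (· ≤ ·) (s : Set P)) (h0 : ∀ z ∈ A, ∀ p ∉ s, (g z).1 p = 0)
    (hc : ∀ p, ContinuousOn (fun z => (g z).1 p) A) : ContinuousOn g A :=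
  continuousOn_iff_continuous_domRestrict.2 <|
    continuous_of_support_subset s hs (fun z => h0 z z.2) fun p =>
      continuousOn_iff_continuous_domRestrict.1 (hc p)

theorem continuous_dom {Y : Type*} [TopologicalSpace Y] {g : ClassifyingSpace P → Y}
    (h : ∀ s hs, Continuous fun x => g (simplexInclusion s hs x)) : Continuous g :=
  continuous_iSup_dom.2 fun s => continuous_coinduced_dom.2 (h s.1 s.2)

/-- Currying turns the claim into continuity of a map from |P| to C(Z, Y), which can be tested on
simplices; local compactness of Z allows uncurrying. With Z = I this makes homotopies on |P|
testable simplex by simplex. -/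
theorem continuous_prod_dom {Z Y : Type*} [TopologicalSpace Z] [LocallyCompactSpace Z]
    [TopologicalSpace Y] {g : Z × ClassifyingSpace P → Y}
    (h : ∀ (s : Finset P) hs, Continuous fun x : Z × stdSimplex ℝ s => g (x.1, simplexInclusion s hs x.2)) :
    Continuous g := by
  have hsec : ∀ x : ClassifyingSpace P, Continuous fun z => g (z, x) := fun x => by
    obtain ⟨y, -, hy⟩ := exists_simplexInclusion_eq x x.1.support x.2.2.2 (by simp)
    rw [← hy]
    exact (h x.1.support x.2.2.2).comp (Continuous.prodMk_left y)
  let G : ClassifyingSpace P → C(Z, Y) := fun x => ⟨fun z => g (z, x), hsec x⟩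
  have hG : Continuous G := continuous_dom fun s hs =>
    ContinuousMap.continuous_of_continuous_uncurry _ ((h s hs).comp continuous_swap)
  have := ContinuousMap.continuous_uncurry_of_continuous ⟨G, hG⟩
  exact this.comp continuous_swap

theorem isOpen_iff {U : Set (ClassifyingSpace P)} :
    IsOpen U ↔ ∀ s hs, IsOpen (simplexInclusion s hs ⁻¹' U) := by
  rw [isOpen_iSup_iff]
  exact ⟨fun h s hs => h ⟨s, hs⟩, fun h s => h s.1 s.2⟩

theorem continuous_coord (p : P) : Continuous fun x : ClassifyingSpace P => x.1 p := by
  refine continuous_dom fun s hs => ?_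
  by_cases hp : p ∈ s
  · have : (fun x => (simplexInclusion s hs x).1 p) = fun x : stdSimplex ℝ s => x.1 ⟨p, hp⟩ :=
      funext fun x => simplexInclusion_coord s hs x ⟨p, hp⟩
    rw [this]
    exact (continuous_apply _).comp continuous_subtype_val
  · simpa only [simplexInclusion_coord_of_notMem s hs _ hp] using continuous_const

instance : T2Space (ClassifyingSpace P) :=
  T2Space.of_injective_continuous (f := fun (x : ClassifyingSpace P) (p : P) => x.1 p)
    (fun _ _ h => ext_coord (congrFun h)) (continuous_pi continuous_coord)

theorem isChain_pair {a b : P} (hab : a ≤ b ∨ b ≤ a) : IsChain (· ≤ ·) ({a, b} : Set P) := by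
  rintro x (rfl | rfl) y (rfl | rfl) h
  exacts [absurd rfl h, hab, hab.symm, absurd rfl h]

/-- The vertex of `|P|` given by an element of `P`. -/
noncomputable def vertex (a : P) : ClassifyingSpace P :=
  ⟨Finsupp.single a 1, fun p => by
      classical
      rw [Finsupp.single_apply]
      split_ifs <;> norm_num,
    by simp, by
      refine (Set.subsingleton_singleton (a := a)).isChain.mono fun p hp => ?_
      exact Finset.mem_singleton.1 (Finsupp.support_single_subset hp)⟩

theorem vertex_coord_self (a : P) : (vertex a).1 a = 1 :=
  Finsupp.single_eq_same

theorem vertex_coord_of_ne {a p : P} (h : p ≠ a) : (vertex a).1 p = 0 :=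
  Finsupp.single_eq_of_ne h

theorem eq_vertex_of_forall {x : ClassifyingSpace P} {a : P} (h : ∀ p ≠ a, x.1 p = 0) :
    x = vertex a := by
  classical
  have h1 := x.sum_coord_of_subset {a} (by simpa using h)
  rw [Finset.sum_singleton] at h1
  refine ext_coord fun p => ?_
  by_cases hp : p = a
  · subst hp
    rw [h1, vertex_coord_self]
  · rw [h p hp, vertex_coord_of_ne hp]

theorem map_coord (f : P →o Q) (x : ClassifyingSpace P) :
    (map f x).1 = Finsupp.mapDomain f x.1 :=
  rfl

theorem map_coord_of_fibre (f : P →o Q) (x : ClassifyingSpace P) {p : P}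
    (h : ∀ p', f p' = f p → x.1 p' ≠ 0 → p' = p) : (map f x).1 (f p) = x.1 p := by
  classical
  rw [map_coord, Finsupp.mapDomain, Finsupp.sum_apply, Finsupp.sum]
  simp only [Finsupp.single_apply]
  rw [Finset.sum_eq_single p]
  · simp
  · intro b hb hbp
    rw [if_neg]
    exact fun hf => hbp (h b hf (Finsupp.mem_support_iff.1 hb))
  · intro hp
    simpa using hp

theorem map_coord_ne_zero_iff (f : P →o Q) (x : ClassifyingSpace P) {q : Q} :
    (map f x).1 q ≠ 0 ↔ ∃ p, f p = q ∧ x.1 p ≠ 0 := by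
  classical
  rw [map_coord, Finsupp.mapDomain, Finsupp.sum_apply, Finsupp.sum]
  simp only [Finsupp.single_apply]
  rw [Ne, Finset.sum_eq_zero_iff_of_nonneg fun p _ => by split_ifs <;> simp [coord_nonneg]]
  push Not
  simp only [Finsupp.mem_support_iff]
  refine exists_congr fun p => ?_
  by_cases h : f p = q <;> simp [h]

end Coordinates

end ClassifyingSpace

/-! ### Collapsing an edge onto one of its endpoints -/

namespace ClassifyingSpace

open Topology unitInterval

section PushWeight

variable {P : Type*}

/-- The factor by which the coordinates outside of `{a, b}` are shrunk. -/
noncomputable def shrink (t s : ℝ) : ℝ :=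
  max 0 (1 - 2 * s * t)

/-- The proportion of the weight of `a` that is moved to `b`. -/
noncomputable def shift (t s : ℝ) : ℝ :=
  max 0 (2 * s * t - 1)

theorem shrink_eq_zero {t s : ℝ} (h : 1 ≤ 2 * s * t) : shrink t s = 0 :=
  max_eq_left (by linarith)

theorem shift_eq_zero {t s : ℝ} (h : 2 * s * t ≤ 1) : shift t s = 0 :=
  max_eq_left (by linarith)

/-- The unnormalized barycentric coordinates of a point in the course of collapsing the edge from
`a` to `b`. -/
noncomputable def pushWeight (a b : P) (t : ℝ) (x : P →₀ ℝ) : P →₀ ℝ :=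
  shrink t (x a + x b) • x +
    Finsupp.single a ((1 - shift t (x a + x b) - shrink t (x a + x b)) * x a) +
    Finsupp.single b ((1 - shrink t (x a + x b)) * x b + shift t (x a + x b) * x a)

variable {a b : P}

theorem degree_pushWeight (t : ℝ) (x : P →₀ ℝ) (hx : x.degree = 1) :
    (pushWeight a b t x).degree =
      shrink t (x a + x b) + (1 - shrink t (x a + x b)) * (x a + x b) := by
  have h : (shrink t (x a + x b) • x).degree = shrink t (x a + x b) * x.degree := by
    refine (Finsupp.sum_smul_index' (h := fun _ t => t) fun _ => rfl).trans ?_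
    simp only [smul_eq_mul, Finsupp.sum, Finsupp.degree_apply, Finset.mul_sum]
  rw [pushWeight, map_add, map_add, h, hx, Finsupp.degree_single, Finsupp.degree_single]
  ring

theorem pushWeight_left (hab : a ≠ b) (t : ℝ) (x : P →₀ ℝ) :
    pushWeight a b t x a = (1 - shift t (x a + x b)) * x a := by
  simp only [pushWeight, Finsupp.add_apply, Finsupp.smul_apply, smul_eq_mul,
    Finsupp.single_eq_same, Finsupp.single_eq_of_ne hab]
  ring

theorem pushWeight_right (hab : a ≠ b) (t : ℝ) (x : P →₀ ℝ) :
    pushWeight a b t x b = x b + shift t (x a + x b) * x a := by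
  simp only [pushWeight, Finsupp.add_apply, Finsupp.smul_apply, smul_eq_mul,
    Finsupp.single_eq_same, Finsupp.single_eq_of_ne hab.symm]
  ring

theorem pushWeight_of_ne {p : P} (ha : p ≠ a) (hb : p ≠ b) (t : ℝ) (x : P →₀ ℝ) :
    pushWeight a b t x p = shrink t (x a + x b) * x p := by
  simp [pushWeight, Finsupp.single_eq_of_ne ha, Finsupp.single_eq_of_ne hb]

/-- The push has two phases, governed by 2st with s = x a + x b. Up to 2st = 1 the other coordinates
shrink to 0 and no new vertex enters the support; only then does weight pass from a to b. This order
matters because b need not be comparable to the rest of the support. -/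
theorem pushWeight_eq_zero_of_le (hab : a ≠ b) {t : ℝ} {x : P →₀ ℝ}
    (h : 2 * (x a + x b) * t ≤ 1) {p : P} (hp : x p = 0) : pushWeight a b t x p = 0 := by
  by_cases ha : p = a
  · subst ha
    rw [pushWeight_left hab, hp, mul_zero]
  by_cases hb : p = b
  · subst hb
    rw [pushWeight_right hab, shift_eq_zero h, hp, zero_mul, zero_add]
  · rw [pushWeight_of_ne ha hb, hp, mul_zero]

theorem pushWeight_eq_zero_of_ge {t : ℝ} {x : P →₀ ℝ}
    (h : 1 ≤ 2 * (x a + x b) * t) {p : P} (ha : p ≠ a) (hb : p ≠ b) :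
    pushWeight a b t x p = 0 := by
  rw [pushWeight_of_ne ha hb, shrink_eq_zero h, zero_mul]

end PushWeight

/-! ### The edge collapse as a deformation of |P| -/

section Push

variable {P : Type*} [PartialOrder P] {a b : P}

/-- With s = x a + x b and shrinking factor φ, the degree is s + φ(1 - s) ≥ s; when s = 0, φ = 1 and
the degree is 1. -/
theorem degree_pushWeight_pos (hab : a ≠ b) (t : ℝ) (x : ClassifyingSpace P) :
    0 < (pushWeight a b t x.1).degree := by
  rw [degree_pushWeight t x.1 x.degree_eq_one]
  have h0 : 0 ≤ x.1 a + x.1 b := add_nonneg (x.2.1 a) (x.2.1 b)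
  have h1 := x.coord_add_coord_le_one hab
  have h2 : 0 ≤ shrink t (x.1 a + x.1 b) := le_max_left _ _
  rcases h0.eq_or_lt with h | h
  · rw [← h]
    simp [shrink]
  · nlinarith [mul_nonneg h2 (sub_nonneg.2 h1)]

theorem pushWeight_nonneg (hab : a ≠ b) (t : I) (x : ClassifyingSpace P) (p : P) :
    0 ≤ pushWeight a b t x.1 p := by
  have h1 := x.coord_add_coord_le_one hab
  have h0 : 0 ≤ x.1 a + x.1 b := add_nonneg (x.2.1 a) (x.2.1 b)
  have h2 : 0 ≤ shift t (x.1 a + x.1 b) := le_max_left _ _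
  have h3 : shift t (x.1 a + x.1 b) ≤ 1 :=
    max_le zero_le_one (by nlinarith [t.2.1, t.2.2])
  by_cases ha : p = a
  · subst ha
    rw [pushWeight_left hab]
    exact mul_nonneg (sub_nonneg.2 h3) (x.2.1 p)
  by_cases hb : p = b
  · subst hb
    rw [pushWeight_right hab]
    exact add_nonneg (x.2.1 p) (mul_nonneg h2 (x.2.1 a))
  · rw [pushWeight_of_ne ha hb]
    exact mul_nonneg (le_max_left _ _) (x.2.1 p)

/-- A stage of the deformation of `|P|` that collapses the edge from `a` to `b` onto `b`. -/
noncomputable def pushFun (hab : a ≠ b) (hc : a ≤ b ∨ b ≤ a) (z : I × ClassifyingSpace P) :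
    ClassifyingSpace P :=
  ⟨(pushWeight a b z.1 z.2.1).degree⁻¹ • pushWeight a b z.1 z.2.1, fun p =>
      mul_nonneg (inv_nonneg.2 (degree_pushWeight_pos hab _ _).le) (pushWeight_nonneg hab _ _ _), by
    have h := degree_pushWeight_pos hab z.1 z.2
    rw [Finsupp.sum_smul_index' fun _ => rfl]
    simp only [smul_eq_mul]
    rw [Finsupp.sum, ← Finset.mul_sum, ← Finsupp.degree_apply, inv_mul_cancel₀ h.ne'], by
    rcases le_total (2 * (z.2.1 a + z.2.1 b) * z.1) 1 with h | h
    · refine z.2.2.2.2.mono fun p hp => ?_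
      simp only [Finset.mem_coe, Finsupp.mem_support_iff] at hp ⊢
      contrapose! hp
      rw [Finsupp.smul_apply, pushWeight_eq_zero_of_le hab h hp, smul_zero]
    · refine (isChain_pair hc).mono fun p hp => ?_
      simp only [Finset.mem_coe, Finsupp.mem_support_iff] at hp
      contrapose! hp
      simp only [Set.mem_insert_iff, Set.mem_singleton_iff, not_or] at hp
      rw [Finsupp.smul_apply, pushWeight_eq_zero_of_ge h hp.1 hp.2, smul_zero]⟩

theorem pushFun_coord (hab : a ≠ b) (hc : a ≤ b ∨ b ≤ a) (z : I × ClassifyingSpace P) (p : P) :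
    (pushFun hab hc z).1 p =
      (pushWeight a b z.1 z.2.1).degree⁻¹ * pushWeight a b z.1 z.2.1 p :=
  rfl

/-- Continuous coordinates suffice only while the values stay in one closed simplex. Each I ×
simplex is therefore cut into two closed pieces, one per phase: on the first the values stay in the
given simplex, on the second in the edge {a, b}. -/
theorem continuous_pushFun (hab : a ≠ b) (hc : a ≤ b ∨ b ≤ a) : Continuous (pushFun hab hc) := by
  classical
  have hcoord : ∀ p, Continuous fun z : I × ClassifyingSpace P => z.2.1 p := fun p =>
    (continuous_coord p).comp continuous_snd
  have hs : Continuous fun z : I × ClassifyingSpace P => z.2.1 a + z.2.1 b :=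
    (hcoord a).add (hcoord b)
  have ht : Continuous fun z : I × ClassifyingSpace P => (z.1 : ℝ) :=
    continuous_subtype_val.comp continuous_fst
  have hst : Continuous fun z : I × ClassifyingSpace P => 2 * (z.2.1 a + z.2.1 b) * z.1 :=
    (continuous_const.mul hs).mul ht
  have hφ : Continuous fun z : I × ClassifyingSpace P => shrink z.1 (z.2.1 a + z.2.1 b) :=
    continuous_const.max (continuous_const.sub hst)
  have hψ : Continuous fun z : I × ClassifyingSpace P => shift z.1 (z.2.1 a + z.2.1 b) :=
    continuous_const.max (hst.sub continuous_const)
  have hw : ∀ p, Continuous fun z : I × ClassifyingSpace P => pushWeight a b z.1 z.2.1 p := by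
    intro p
    by_cases ha : p = a
    · subst ha
      simp only [pushWeight_left hab]
      exact (continuous_const.sub hψ).mul (hcoord p)
    by_cases hb : p = b
    · subst hb
      simp only [pushWeight_right hab]
      exact (hcoord p).add (hψ.mul (hcoord a))
    · simp only [pushWeight_of_ne ha hb]
      exact hφ.mul (hcoord p)
  have hd : Continuous fun z : I × ClassifyingSpace P => (pushWeight a b z.1 z.2.1).degree⁻¹ := by
    refine Continuous.inv₀ ?_ fun z => (degree_pushWeight_pos hab z.1 z.2).ne'
    simp only [degree_pushWeight _ _ (degree_eq_one _)]
    exact hφ.add ((continuous_const.sub hφ).mul hs)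
  have hpush : ∀ p, Continuous fun z => (pushFun hab hc z).1 p := fun p => hd.mul (hw p)
  refine continuous_prod_dom fun s hs => ?_
  have hi : Continuous fun z : I × stdSimplex ℝ s => (z.1, simplexInclusion s hs z.2) :=
    continuous_fst.prodMk ((continuous_simplexInclusion s hs).comp continuous_snd)
  have hsti : Continuous fun z : I × stdSimplex ℝ s =>
      2 * ((simplexInclusion s hs z.2).1 a + (simplexInclusion s hs z.2).1 b) * z.1 :=
    hst.comp hi
  rw [← continuousOn_univ]
  have key := ContinuousOn.union_of_isClosed
    (f := fun z : I × stdSimplex ℝ s => pushFun hab hc (z.1, simplexInclusion s hs z.2))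
    (continuousOn_of_support_subset s hs (fun z hz p hp => ?_)
      fun p => ((hpush p).comp hi).continuousOn)
    (continuousOn_of_support_subset {a, b} (by simpa using isChain_pair hc) (fun z hz p hp => ?_)
      fun p => ((hpush p).comp hi).continuousOn)
    (isClosed_le hsti (continuous_const (y := 1)))
    (isClosed_le (continuous_const (y := 1)) hsti)
  · exact key.mono fun z _ => le_total (2 * ((simplexInclusion s hs z.2).1 a +
      (simplexInclusion s hs z.2).1 b) * z.1) 1
  · rw [pushFun_coord, pushWeight_eq_zero_of_le hab hz
      (simplexInclusion_coord_of_notMem s hs _ hp), mul_zero]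
  · simp only [Finset.mem_insert, Finset.mem_singleton, not_or] at hp
    rw [pushFun_coord, pushWeight_eq_zero_of_ge hz hp.1 hp.2, mul_zero]

theorem pushFun_zero (hab : a ≠ b) (hc : a ≤ b ∨ b ≤ a) (x : ClassifyingSpace P) :
    pushFun hab hc (0, x) = x := by
  have hφ : shrink 0 (x.1 a + x.1 b) = 1 := by simp [shrink]
  have hψ : shift 0 (x.1 a + x.1 b) = 0 := by simp [shift]
  have hd : (pushWeight a b 0 x.1).degree = 1 := by
    rw [degree_pushWeight _ _ x.degree_eq_one, hφ]
    ring
  refine ext_coord fun p => ?_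
  rw [pushFun_coord]
  simp only [Set.Icc.coe_zero, hd]
  simp [pushWeight, hφ, hψ]

theorem pushFun_of_eq_zero (hab : a ≠ b) (hc : a ≤ b ∨ b ≤ a) {x : ClassifyingSpace P}
    (ha : x.1 a = 0) (hb : x.1 b = 0) (t : I) : pushFun hab hc (t, x) = x := by
  have hφ : shrink t (x.1 a + x.1 b) = 1 := by simp [shrink, ha, hb]
  have hd : (pushWeight a b t x.1).degree = 1 := by
    rw [degree_pushWeight _ _ x.degree_eq_one, hφ]
    ring
  refine ext_coord fun p => ?_
  rw [pushFun_coord]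
  simp only [hd]
  rw [inv_one, one_mul, pushWeight, hφ, ha, hb]
  simp

theorem pushFun_coord_eq_zero (hab : a ≠ b) (hc : a ≤ b ∨ b ≤ a) {x : ClassifyingSpace P} {p : P}
    (hp : x.1 p = 0) (hb : p ≠ b) (t : I) : (pushFun hab hc (t, x)).1 p = 0 := by
  rw [pushFun_coord]
  by_cases ha : p = a
  · subst ha
    rw [pushWeight_left hab, hp, mul_zero, mul_zero]
  · rw [pushWeight_of_ne ha hb, hp, mul_zero, mul_zero]

theorem pushFun_one_of_add_eq_one (hab : a ≠ b) (hc : a ≤ b ∨ b ≤ a) {x : ClassifyingSpace P}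
    (h : x.1 a + x.1 b = 1) : pushFun hab hc (1, x) = vertex b := by
  refine eq_vertex_of_forall fun p hp => ?_
  rw [pushFun_coord]
  by_cases ha : p = a
  · subst ha
    rw [pushWeight_left hab, h]
    norm_num [shift]
  · rw [pushWeight_of_ne ha hp, h]
    norm_num [shrink]

/-- The map `|P| → |P|` that collapses the edge from `a` to `b` onto `b`. -/
noncomputable def push (hab : a ≠ b) (hc : a ≤ b ∨ b ≤ a) :
    C(ClassifyingSpace P, ClassifyingSpace P) :=
  ⟨fun x => pushFun hab hc (1, x), (continuous_pushFun hab hc).comp (Continuous.prodMk_right 1)⟩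

/-- The deformation of `|P|` that collapses the edge from `a` to `b` onto `b`. -/
noncomputable def pushHomotopy (hab : a ≠ b) (hc : a ≤ b ∨ b ≤ a) :
    (ContinuousMap.id (ClassifyingSpace P)).Homotopy (push hab hc) where
  toFun := pushFun hab hc
  continuous_toFun := continuous_pushFun hab hc
  map_zero_left := pushFun_zero hab hc
  map_one_left _ := rfl

end Push

end ClassifyingSpace

/-! ### Deformations along the fibres of a quotient map -/

section FibrewiseDeformation

open Topology unitInterval

variable {X Y : Type*} [TopologicalSpace X] [TopologicalSpace Y]

/-- `g` is the end of a deformation of `X` that is compatible with the fibres of `q`. -/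
def IsFibrewiseDeformation (q : C(X, Y)) (g : C(X, X)) : Prop :=
  ∃ F : (ContinuousMap.id X).Homotopy g, ∀ t x y, q x = q y → q (F (t, x)) = q (F (t, y))

namespace IsFibrewiseDeformation

variable {q : C(X, Y)} {g g' : C(X, X)}

theorem refl (q : C(X, Y)) : IsFibrewiseDeformation q (ContinuousMap.id X) :=
  ⟨ContinuousMap.Homotopy.refl _, fun _ _ _ h => h⟩

theorem apply_eq (h : IsFibrewiseDeformation q g) {x y : X} (hxy : q x = q y) :
    q (g x) = q (g y) := by
  obtain ⟨F, hF⟩ := h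
  simpa using hF 1 x y hxy

theorem comp (h' : IsFibrewiseDeformation q g') (h : IsFibrewiseDeformation q g) :
    IsFibrewiseDeformation q (g'.comp g) := by
  have hg := fun x y => h.apply_eq (x := x) (y := y)
  obtain ⟨F, hF⟩ := h
  obtain ⟨F', hF'⟩ := h'
  refine ⟨F.trans ((F'.compContinuousMap g).cast (ContinuousMap.id_comp g) rfl),
    fun t x y hxy => ?_⟩
  rw [ContinuousMap.Homotopy.trans_apply, ContinuousMap.Homotopy.trans_apply]
  split_ifs
  · exact hF _ _ _ hxy
  · exact hF' _ _ _ (hg x y hxy)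

/-- A quotient map is a homotopy equivalence if its fibres are contracted by a fibrewise
deformation. -/
theorem isHomotopyEquivalence (hq : IsQuotientMap q) (h : IsFibrewiseDeformation q g)
    (hg : ∀ x y, q x = q y → g x = g y) : IsHomotopyEquivalence q := by
  obtain ⟨F, hF⟩ := h
  let r : C(Y, X) := hq.lift g fun x y hxy => hg x y hxy
  have hr : ∀ x, r (q x) = g x := fun x => congrArg (· x) (hq.lift_comp g fun x y hxy => hg x y hxy)
  -- This section need not be continuous. Fibrewise compatibility makes q (F (t, s y)) independent
  -- of its choice, and continuity follows because I × q is again a quotient map.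
  let s : Y → X := Function.surjInv hq.surjective
  have hs : ∀ y, q (s y) = y := Function.surjInv_eq hq.surjective
  have hK : Continuous fun z : I × Y => q (F (z.1, s z.2)) := by
    refine hq.continuous_lift_prod_right ?_
    have : (fun p : I × X => q (F (p.1, s (q p.2)))) = fun p => q (F p) :=
      funext fun p => hF _ _ _ (hs _)
    simp only [this]
    fun_prop
  refine ⟨⟨q, r, ?_, ?_⟩, rfl⟩
  · refine ContinuousMap.Homotopic.symm ⟨F.cast rfl ?_⟩
    ext x
    exact (hr x).symm
  · refine ContinuousMap.Homotopic.symm ⟨⟨⟨_, hK⟩, fun y => ?_, fun y => ?_⟩⟩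
    · simp [hs]
    · simp [← hr, hs]

end IsFibrewiseDeformation

end FibrewiseDeformation

/-! ### The arc of a zigzag -/

namespace ClassifyingSpace

open Topology unitInterval

section Arc

variable {P : Type*} [PartialOrder P]

/-- The parametrized edge of `|P|` from `a` to `b`. -/
noncomputable def edge {a b : P} (hc : a ≤ b ∨ b ≤ a) (t : I) : ClassifyingSpace P :=
  ⟨Finsupp.single a (1 - t : ℝ) + Finsupp.single b (t : ℝ), fun p => by
      classical
      rw [Finsupp.add_apply, Finsupp.single_apply, Finsupp.single_apply]
      have := t.2.1
      have := t.2.2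
      split_ifs <;> linarith, by
    rw [Finsupp.sum_add_index' (fun _ => rfl) fun _ _ _ => rfl, Finsupp.sum_single_index rfl,
      Finsupp.sum_single_index rfl, sub_add_cancel], by
    refine (isChain_pair hc).mono fun p hp => ?_
    simp only [Finset.mem_coe, Finsupp.mem_support_iff, Finsupp.add_apply] at hp
    contrapose! hp
    simp only [Set.mem_insert_iff, Set.mem_singleton_iff, not_or] at hp
    rw [Finsupp.single_eq_of_ne hp.1, Finsupp.single_eq_of_ne hp.2, add_zero]⟩

theorem edge_coord {a b : P} (hc : a ≤ b ∨ b ≤ a) (t : I) (p : P) :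
    (edge hc t).1 p = Finsupp.single a (1 - t : ℝ) p + Finsupp.single b (t : ℝ) p :=
  rfl

theorem edge_coord_of_ne {a b p : P} (hc : a ≤ b ∨ b ≤ a) (t : I) (ha : p ≠ a) (hb : p ≠ b) :
    (edge hc t).1 p = 0 := by
  rw [edge_coord, Finsupp.single_eq_of_ne ha, Finsupp.single_eq_of_ne hb, add_zero]

theorem continuous_edge {a b : P} (hc : a ≤ b ∨ b ≤ a) : Continuous (edge hc) := by
  classical
  refine continuous_of_support_subset {a, b} (by simpa using isChain_pair hc)
    (fun t p hp => ?_) fun p => ?_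
  · simp only [Finset.mem_insert, Finset.mem_singleton, not_or] at hp
    exact edge_coord_of_ne hc t hp.1 hp.2
  · simp only [edge_coord, Finsupp.single_apply]
    split_ifs <;> fun_prop

theorem edge_zero {a b : P} (hc : a ≤ b ∨ b ≤ a) : edge hc 0 = vertex a := by
  refine eq_vertex_of_forall fun p hp => ?_
  rw [edge_coord, Finsupp.single_eq_of_ne hp]
  simp

theorem edge_one {a b : P} (hc : a ≤ b ∨ b ≤ a) : edge hc 1 = vertex b := by
  refine eq_vertex_of_forall fun p hp => ?_
  rw [edge_coord, Finsupp.single_eq_of_ne hp]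
  simp

theorem exists_edge_eq {a b : P} (hab : a ≠ b) (hc : a ≤ b ∨ b ≤ a) (x : ClassifyingSpace P)
    (h : ∀ p, p ≠ a → p ≠ b → x.1 p = 0) : ∃ t, edge hc t = x := by
  classical
  have h1 := x.sum_coord_of_subset {a, b} fun p hp => by
    simp only [Finset.mem_insert, Finset.mem_singleton, not_or] at hp
    exact h p hp.1 hp.2
  rw [Finset.sum_pair hab] at h1
  have ha := x.2.1 a
  refine ⟨⟨x.1 b, x.2.1 b, by linarith⟩, ext_coord fun p => ?_⟩
  rw [edge_coord]
  by_cases hp : p = a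
  · subst hp
    rw [Finsupp.single_eq_same, Finsupp.single_eq_of_ne hab]
    simp only
    linarith
  by_cases hp' : p = b
  · subst hp'
    rw [Finsupp.single_eq_same, Finsupp.single_eq_of_ne hab.symm, zero_add]
  · rw [Finsupp.single_eq_of_ne hp, Finsupp.single_eq_of_ne hp', h p hp hp', add_zero]

/-- A zigzag `k 0, …, k 4` of distinct elements in which exactly the consecutive ones are
comparable. -/
structure IsZigzag (k : Fin 5 → P) : Prop where
  injective : Function.Injective k
  comparable : ∀ j : Fin 4, k j.castSucc ≤ k j.succ ∨ k j.succ ≤ k j.castSucc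
  le_succ_of_le : ∀ j l, k j ≤ k l → (j : ℕ) ≤ l + 1 ∧ (l : ℕ) ≤ j + 1

namespace IsZigzag

variable {k : Fin 5 → P} (hk : IsZigzag k)

include hk

theorem castSucc_ne_succ (j : Fin 4) : k j.castSucc ≠ k j.succ := fun h =>
  j.castSucc_lt_succ.ne (hk.injective h)

/-- If j is the least index in the support, comparability leaves only j and j + 1. -/
theorem exists_edge_eq {x : ClassifyingSpace P} (hx : ∀ p, x.1 p ≠ 0 → ∃ j, k j = p) :
    ∃ j t, edge (hk.comparable j) t = x := by
  classical
  have hne : ∃ j, x.1 (k j) ≠ 0 := by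
    obtain ⟨p, hp⟩ := x.exists_coord_ne_zero
    obtain ⟨j, rfl⟩ := hx p hp
    exact ⟨j, hp⟩
  obtain ⟨j, hj, hmin⟩ := exists_minimal_of_wellFoundedLT (fun j => x.1 (k j) ≠ 0) hne
  have hnear : ∀ l, x.1 (k l) ≠ 0 → j ≤ l ∧ (l : ℕ) ≤ j + 1 := fun l hl => by
    refine ⟨(le_total j l).elim id fun h => hmin hl h, ?_⟩
    rcases x.comparable hj hl with h | h
    exacts [(hk.le_succ_of_le _ _ h).2, (hk.le_succ_of_le _ _ h).1]
  have key : ∀ i : Fin 4, (∀ l, x.1 (k l) ≠ 0 → l = i.castSucc ∨ l = i.succ) →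
      ∃ j t, edge (hk.comparable j) t = x := fun i hi => by
    refine ⟨i, ClassifyingSpace.exists_edge_eq (hk.castSucc_ne_succ i) _ x fun p h1 h2 => ?_⟩
    by_contra hp
    obtain ⟨l, rfl⟩ := hx p hp
    rcases hi l hp with rfl | rfl
    exacts [h1 rfl, h2 rfl]
  by_cases h4 : (j : ℕ) < 4
  · refine key ⟨j, h4⟩ fun l hl => ?_
    have := hnear l hl
    simp only [Fin.ext_iff, Fin.le_def, Fin.val_castSucc, Fin.val_succ] at this ⊢
    omega
  -- No edge starts at index 4; the point is then the far end of edge 3.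
  · refine key 3 fun l hl => Or.inr ?_
    have := (hnear l hl).1
    simp only [Fin.ext_iff, Fin.le_def, Fin.val_succ] at this ⊢
    omega

/-- The mean index of a point is the coordinate that will identify the arc with [0, 4]. -/
theorem position_edge (j : Fin 4) (t : I) :
    ∑ l : Fin 5, (l : ℝ) * (edge (hk.comparable j) t).1 (k l) = j + t := by
  classical
  simp only [edge_coord, Finsupp.single_apply, hk.injective.eq_iff, mul_add, mul_ite, mul_zero,
    Finset.sum_add_distrib, Finset.sum_ite_eq, Finset.mem_univ, if_true]
  simp only [Fin.val_castSucc, Fin.val_succ]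
  push_cast
  ring

theorem edge_eq_of_position {j j' : Fin 4} {t t' : I} (h : (j + t : ℝ) = j' + t') (hj : j ≤ j') :
    edge (hk.comparable j) t = edge (hk.comparable j') t' := by
  rcases hj.eq_or_lt with rfl | hj
  · rw [Subtype.ext (add_left_cancel h)]
  · have h1 : ((j : ℕ) + 1 : ℝ) ≤ (j' : ℕ) := by exact_mod_cast hj
    have ht := t.2.2
    have ht' := t'.2.1
    have e : t = 1 := Subtype.ext (by simp only [Set.Icc.coe_one]; linarith)
    have e' : t' = 0 := Subtype.ext (by simp only [Set.Icc.coe_zero]; linarith)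
    have hs : j.succ = j'.castSucc := by
      have : ((j : ℕ) + 1 : ℝ) = (j' : ℕ) := by simpa [e, e'] using h
      exact Fin.ext (by simpa using mod_cast this)
    rw [e, e', edge_one, edge_zero, hs]

/-- The subspace of `|P|` spanned by a zigzag is an arc. -/
theorem nonempty_homeomorph :
    Nonempty ({x : ClassifyingSpace P | ∀ p, x.1 p ≠ 0 → ∃ j, k j = p} ≃ₜ I) := by
  set A := {x : ClassifyingSpace P | ∀ p, x.1 p ≠ 0 → ∃ j, k j = p} with hA
  have hmem : ∀ j t, edge (hk.comparable j) t ∈ A := fun j t p hp => by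
    by_contra! h
    exact hp (edge_coord_of_ne _ _ (h _).symm (h _).symm)
  have hunion : A = ⋃ j, Set.range (edge (hk.comparable j)) := by
    ext x
    simp only [Set.mem_iUnion, Set.mem_range]
    refine ⟨fun h => hk.exists_edge_eq h, ?_⟩
    rintro ⟨j, t, rfl⟩
    exact hmem j t
  have : CompactSpace A := by
    rw [← isCompact_iff_compactSpace, hunion]
    exact isCompact_iUnion fun j => isCompact_range (continuous_edge _)
  have hpos : ∀ x : A, (∑ l : Fin 5, (l : ℝ) * x.1.1 (k l)) / 4 ∈ I := fun x => by
    obtain ⟨j, t, h⟩ := hk.exists_edge_eq x.2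
    rw [← h, hk.position_edge]
    have := t.2.1
    have := t.2.2
    have : ((j : ℕ) + 1 : ℝ) ≤ 4 := by exact_mod_cast j.2
    constructor
    · positivity
    · linarith
  let e : A → I := fun x => ⟨_, hpos x⟩
  have hcont : Continuous e := by
    refine Continuous.subtype_mk ?_ _
    refine Continuous.div_const (continuous_finsetSum _ fun l _ => ?_) _
    exact continuous_const.mul ((continuous_coord (k l)).comp continuous_subtype_val)
  have hbij : Function.Bijective e := by
    constructor
    · intro x y hxy
      obtain ⟨j, t, hx⟩ := hk.exists_edge_eq x.2
      obtain ⟨j', t', hy⟩ := hk.exists_edge_eq y.2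
      have h := congrArg (fun s : I => (s : ℝ) * 4) hxy
      simp only [e, div_mul_cancel₀ _ (four_ne_zero (α := ℝ)), ← hx, ← hy,
        hk.position_edge] at h
      refine Subtype.ext (hx.symm.trans (Eq.trans ?_ hy))
      rcases le_total j j' with hj | hj
      exacts [hk.edge_eq_of_position h hj, (hk.edge_eq_of_position h.symm hj).symm]
    · intro s
      have hs0 := s.2.1
      have hs1 := s.2.2
      have : ∃ j : Fin 4, (j : ℝ) ≤ 4 * s ∧ 4 * s ≤ (j + 1 : ℝ) := by
        rcases le_total (4 * (s : ℝ)) 1 with h1 | h1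
        · exact ⟨0, by norm_num; linarith, by norm_num; linarith⟩
        rcases le_total (4 * (s : ℝ)) 2 with h2 | h2
        · exact ⟨1, by norm_num; linarith, by norm_num; linarith⟩
        rcases le_total (4 * (s : ℝ)) 3 with h3 | h3
        · exact ⟨2, by norm_num; linarith, by norm_num; linarith⟩
        · exact ⟨3, by norm_num; linarith, by norm_num; linarith⟩
      obtain ⟨j, h0, h1⟩ := this
      refine ⟨⟨_, hmem j ⟨4 * s - j, by linarith, by linarith⟩⟩, Subtype.ext ?_⟩
      simp only [e, hk.position_edge]
      ring
  exact ⟨hcont.homeoOfEquivCompactToT2 (f := Equiv.ofBijective e hbij)⟩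

end IsZigzag

end Arc

end ClassifyingSpace

/-! ### Order-preserving maps collapsing two zigzags -/

namespace ClassifyingSpace

open Topology unitInterval

section Collapse

variable {P Q : Type*} [PartialOrder P] [PartialOrder Q]

/-- `f` collapses the two zigzags `k 0` and `k 1` to two minimal elements `z 0` and `z 1` and is
an isomorphism elsewhere; elements outside of a zigzag are comparable to at most one of its
elements, and this is one of its two ends. -/
structure IsZigzagCollapse (f : P →o Q) (z : Fin 2 → Q) (k : Fin 2 → Fin 5 → P) : Prop where
  surjective : Function.Surjective f
  injective_base : Function.Injective z
  isZigzag : ∀ i, IsZigzag (k i)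
  fibre : ∀ i p, f p = z i ↔ ∃ j, k i j = p
  minimal : ∀ i q, q ≤ z i → q = z i
  le_of_map_le : ∀ p p', f p ≤ f p' → (∀ i, f p ≠ z i) → p ≤ p'
  end_le : ∀ i p, z i ≤ f p → f p ≠ z i → k i 0 ≤ p ∨ k i 4 ≤ p
  not_both : ∀ i p, f p ≠ z i → ¬ (k i 0 ≤ p ∧ k i 4 ≤ p)
  eq_end : ∀ i j p, k i j ≤ p → f p ≠ z i → j = 0 ∨ j = 4

/-- The part of `|P|` over the vertex `q`. -/
def fibreOver (f : P →o Q) (q : Q) : Set (ClassifyingSpace P) :=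
  {x | ∀ p, x.1 p ≠ 0 → f p = q}

theorem mem_fibreOver_iff {f : P →o Q} {q : Q} {x : ClassifyingSpace P} :
    x ∈ fibreOver f q ↔ map f x = vertex q := by
  constructor
  · refine fun h => eq_vertex_of_forall fun q' hq' => ?_
    by_contra hne
    obtain ⟨p, rfl, hp⟩ := (map_coord_ne_zero_iff f x).1 hne
    exact hq' (h p hp)
  · intro h p hp
    by_contra hne
    refine (map_coord_ne_zero_iff f x).2 ⟨p, rfl, hp⟩ ?_
    rw [h, vertex_coord_of_ne hne]

namespace IsZigzagCollapse

variable {f : P →o Q} {z : Fin 2 → Q} {k : Fin 2 → Fin 5 → P}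

theorem map_zigzag (h : IsZigzagCollapse f z k) (i : Fin 2) (j : Fin 5) : f (k i j) = z i :=
  (h.fibre i _).2 ⟨j, rfl⟩

theorem eq_of_map_eq (h : IsZigzagCollapse f z k) {p p' : P} (hp : f p = f p')
    (hz : ∀ i, f p ≠ z i) : p = p' :=
  le_antisymm (h.le_of_map_le p p' hp.le hz) (h.le_of_map_le p' p hp.ge (hp ▸ hz))

theorem ne_base_of_lt (h : IsZigzagCollapse f z k) {i : Fin 2} {q : Q} (hq : z i ≤ q)
    (hne : q ≠ z i) (i' : Fin 2) : q ≠ z i' := by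
  rintro rfl
  exact hne (h.minimal i' _ hq).symm

/-- Minimality of z i puts both elements below u, so both are ends of the zigzag; u is not above
both ends. -/
theorem eq_of_map_eq_of_lt (h : IsZigzagCollapse f z k) {i : Fin 2} {p p' u : P}
    (hp : f p = z i) (hp' : f p' = z i) (hu : f u ≠ z i) (hpu : p ≤ u ∨ u ≤ p)
    (hpu' : p' ≤ u ∨ u ≤ p') : p = p' := by
  have hle : ∀ p, f p = z i → p ≤ u ∨ u ≤ p → p ≤ u := fun p hp hpu =>
    hpu.resolve_right fun hup => hu (h.minimal i _ (hp ▸ f.monotone hup))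
  have h1 := hle p hp hpu
  have h2 := hle p' hp' hpu'
  obtain ⟨j, rfl⟩ := (h.fibre i p).1 hp
  obtain ⟨j', rfl⟩ := (h.fibre i p').1 hp'
  rcases h.eq_end i j u h1 hu with rfl | rfl <;> rcases h.eq_end i j' u h2 hu with rfl | rfl
  · rfl
  · exact absurd ⟨h1, h2⟩ (h.not_both i u hu)
  · exact absurd ⟨h2, h1⟩ (h.not_both i u hu)
  · rfl

theorem map_eq_map (h : IsZigzagCollapse f z k) {x y : ClassifyingSpace P}
    (hxy : map f x = map f y) :
    x = y ∨ ∃ i, x ∈ fibreOver f (z i) ∧ y ∈ fibreOver f (z i) := by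
  by_cases hv : ∃ i, map f x = vertex (z i)
  · obtain ⟨i, hi⟩ := hv
    exact Or.inr ⟨i, mem_fibreOver_iff.2 hi, mem_fibreOver_iff.2 (hxy ▸ hi)⟩
  refine Or.inl ?_
  push Not at hv
  -- It suffices that f is injective on the union of the supports. Over z i, the common image has
  -- another vertex f u above z i; its preimage u is unique, hence in both supports, and fixes which
  -- end of the zigzag occurs.
  have main : ∀ p p', (x.1 p ≠ 0 ∨ y.1 p ≠ 0) → (x.1 p' ≠ 0 ∨ y.1 p' ≠ 0) → f p' = f p →
      p' = p := by
    intro p p' hp hp' hpp'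
    by_cases hz : ∀ i, f p ≠ z i
    · exact (h.eq_of_map_eq hpp'.symm hz).symm
    push Not at hz
    obtain ⟨i, hi⟩ := hz
    have hu : ∃ u, f u ≠ z i ∧ x.1 u ≠ 0 := by
      by_contra! hno
      exact hv i (mem_fibreOver_iff.1 fun u hu => by_contra fun hne => hu (hno u hne))
    obtain ⟨u, huz, hxu⟩ := hu
    have hqu : (map f x).1 (f u) ≠ 0 := (map_coord_ne_zero_iff f x).2 ⟨u, rfl, hxu⟩
    have hqz : (map f x).1 (z i) ≠ 0 := by
      rcases hp with hp | hp
      · exact (map_coord_ne_zero_iff f x).2 ⟨p, hi, hp⟩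
      · exact hxy ▸ (map_coord_ne_zero_iff f y).2 ⟨p, hi, hp⟩
    have hzu : z i ≤ f u := ((map f x).comparable hqz hqu).resolve_right fun hle =>
      huz (h.minimal i _ hle)
    have hyu : y.1 u ≠ 0 := by
      obtain ⟨u', hu', hyu'⟩ := (map_coord_ne_zero_iff f y).1 (hxy ▸ hqu)
      rwa [h.eq_of_map_eq hu'.symm (h.ne_base_of_lt hzu huz)]
    have hcomp : ∀ p, (x.1 p ≠ 0 ∨ y.1 p ≠ 0) → p ≤ u ∨ u ≤ p := fun p hp =>
      hp.elim (fun hp => x.comparable hp hxu) fun hp => y.comparable hp hyu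
    exact h.eq_of_map_eq_of_lt (hpp'.trans hi) hi huz (hcomp p' hp') (hcomp p hp)
  refine ext_coord fun p => ?_
  by_cases hp : x.1 p ≠ 0 ∨ y.1 p ≠ 0
  · rw [← map_coord_of_fibre f x fun p' hf hx => main p p' hp (Or.inl hx) hf, hxy,
      map_coord_of_fibre f y fun p' hf hy => main p p' hp (Or.inr hy) hf]
  · push Not at hp
    rw [hp.1, hp.2]

/-- Only the z i have several preimages. All members of the chain strictly above z i lift above the
same end of the zigzag: their lifts are comparable, and the larger one would otherwise lie above
both ends. -/
theorem exists_chain_section (h : IsZigzagCollapse f z k) (s : Finset Q)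
    (hs : IsChain (· ≤ ·) (s : Set Q)) :
    ∃ l : Q → P, (∀ q, f (l q) = q) ∧ ∀ q ∈ s, ∀ q' ∈ s, q ≤ q' → l q ≤ l q' := by
  classical
  obtain ⟨l₀, hl₀⟩ := h.surjective.hasRightInverse
  -- End 4 is also the default when nothing in the chain lies strictly above z i.
  let c : Fin 2 → Fin 5 := fun i =>
    if ∃ q ∈ s, q ≠ z i ∧ z i ≤ q ∧ k i 0 ≤ l₀ q then 0 else 4
  let l : Q → P := fun q => if hq : ∃ i, q = z i then k hq.choose (c hq.choose) else l₀ q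
  have hlz : ∀ i, l (z i) = k i (c i) := fun i => by
    have hq : ∃ i', z i = z i' := ⟨i, rfl⟩
    have hi : hq.choose = i := (h.injective_base hq.choose_spec).symm
    simp only [l, dif_pos hq, hi]
  have hl : ∀ q, (∀ i, q ≠ z i) → l q = l₀ q := fun q hq => dif_neg (by simpa using hq)
  have hc : ∀ i, ∀ q ∈ s, q ≠ z i → z i ≤ q → k i (c i) ≤ l₀ q := by
    intro i q hq hqz hzq
    have hne : f (l₀ q) ≠ z i := by rwa [hl₀ q]
    have hend := h.end_le i (l₀ q) (by rwa [hl₀ q]) hne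
    by_cases hex : ∃ q ∈ s, q ≠ z i ∧ z i ≤ q ∧ k i 0 ≤ l₀ q
    · have hci : c i = 0 := if_pos hex
      rw [hci]
      obtain ⟨q', hq', hqz', hzq', hk⟩ := hex
      have hne' : f (l₀ q') ≠ z i := by rwa [hl₀ q']
      have hmono : ∀ r r', r ≤ r' → r ≠ z i → z i ≤ r → l₀ r ≤ l₀ r' := fun r r' hr h1 h2 =>
        h.le_of_map_le _ _ (by rwa [hl₀, hl₀]) (by
          rw [hl₀]
          exact h.ne_base_of_lt h2 h1)
      rcases hs.total hq' hq with hle | hle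
      · exact hk.trans (hmono q' q hle hqz' hzq')
      · refine hend.resolve_right fun h4 => h.not_both i _ hne' ⟨hk, ?_⟩
        exact h4.trans (hmono q q' hle hqz hzq)
    · have hci : c i = 4 := if_neg hex
      rw [hci]
      exact hend.resolve_left fun h0 => hex ⟨q, hq, hqz, hzq, h0⟩
  refine ⟨l, fun q => ?_, fun q hq q' hq' hle => ?_⟩
  · by_cases hqz : ∃ i, q = z i
    · obtain ⟨i, rfl⟩ := hqz
      rw [hlz, h.map_zigzag]
    · rw [hl q (by simpa using hqz), hl₀]
  · rcases eq_or_ne q q' with rfl | hne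
    · exact le_rfl
    have hq'z : ∀ i, q' ≠ z i := by
      rintro i rfl
      exact hne (h.minimal i _ hle)
    rw [hl q' hq'z]
    by_cases hqz : ∃ i, q = z i
    · obtain ⟨i, rfl⟩ := hqz
      rw [hlz]
      exact hc i q' hq' (hq'z i) hle
    · rw [hl q (by simpa using hqz)]
      exact h.le_of_map_le _ _ (by rwa [hl₀, hl₀]) (by simpa [hl₀ q] using hqz)

theorem exists_lift_simplexInclusion (h : IsZigzagCollapse f z k) (s : Finset Q)
    (hs : IsChain (· ≤ ·) (s : Set Q)) :
    ∃ L : stdSimplex ℝ s → ClassifyingSpace P,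
      Continuous L ∧ ∀ x, map f (L x) = simplexInclusion s hs x := by
  classical
  obtain ⟨l, hfl, hl⟩ := h.exists_chain_section s hs
  have ht : IsChain (· ≤ ·) ((s.image l : Finset P) : Set P) := by
    rw [Finset.coe_image]
    rintro _ ⟨a, ha, rfl⟩ _ ⟨b, hb, rfl⟩ -
    exact (hs.total ha hb).imp (hl a ha b hb) (hl b hb a ha)
  let l' : s → (s.image l : Finset P) := fun q => ⟨l q.1, Finset.mem_image_of_mem l q.2⟩
  refine ⟨simplexInclusion _ ht ∘ stdSimplex.map l',
    (continuous_simplexInclusion _ ht).comp (stdSimplex.continuous_map l'), fun x => ?_⟩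
  apply Subtype.ext
  change Finsupp.mapDomain f (Finsupp.mapDomain Subtype.val
    (Finsupp.equivFunOnFinite.symm (stdSimplex.map l' x).1)) = Finsupp.mapDomain Subtype.val _
  have h2 : Finsupp.equivFunOnFinite.symm (stdSimplex.map l' x).1 =
      Finsupp.mapDomain l' (Finsupp.equivFunOnFinite.symm x.1) := by
    apply Finsupp.equivFunOnFinite.injective
    rw [Equiv.apply_symm_apply]
    rfl
  rw [h2, ← Finsupp.mapDomain_comp, ← Finsupp.mapDomain_comp]
  congr 1
  exact funext fun q => hfl q.1

/-- Openness in |Q| is tested on closed simplices, and each of them lifts continuously through |f|.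
-/
theorem isQuotientMap (h : IsZigzagCollapse f z k) : IsQuotientMap (map f) := by
  refine (isQuotientMap_iff _).2 ⟨isCoinducing_iff.2 fun U => ⟨fun hU => isOpen_iff.2 fun s hs => ?_,
    fun hU => hU.preimage (map f).continuous⟩, fun y => ?_⟩
  · obtain ⟨L, hLc, hL⟩ := h.exists_lift_simplexInclusion s hs
    have : simplexInclusion s hs ⁻¹' U = L ⁻¹' (map f ⁻¹' U) := by
      ext x
      simp only [Set.mem_preimage, hL]
    rw [this]
    exact hU.preimage hLc
  · obtain ⟨y', -, hy'⟩ := exists_simplexInclusion_eq y y.1.support y.2.2.2 (by simp)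
    obtain ⟨L, -, hL⟩ := h.exists_lift_simplexInclusion y.1.support y.2.2.2
    exact ⟨L y', (hL y').trans hy'⟩

theorem fibreOver_eq (h : IsZigzagCollapse f z k) (i : Fin 2) :
    fibreOver f (z i) = {x | ∀ p, x.1 p ≠ 0 → ∃ j, k i j = p} := by
  simp only [fibreOver, h.fibre]

theorem disjoint_fibreOver (h : IsZigzagCollapse f z k) {i i' : Fin 2} (hi : i ≠ i') :
    Disjoint (fibreOver f (z i)) (fibreOver f (z i')) := by
  refine Set.disjoint_left.2 fun x hx hx' => ?_
  obtain ⟨p, hp⟩ := x.exists_coord_ne_zero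
  exact hi (h.injective_base ((hx p hp).symm.trans (hx' p hp)))

theorem nonempty_homeomorph_fibreOver (h : IsZigzagCollapse f z k) (i : Fin 2) :
    Nonempty (fibreOver f (z i) ≃ₜ I) := by
  rw [h.fibreOver_eq]
  exact (h.isZigzag i).nonempty_homeomorph

/-- Fibres other than the two arcs are points, so only the arcs need checking. On the arc containing
the edge, only b can enter the support; the other arc is fixed. -/
theorem isFibrewiseDeformation_push (h : IsZigzagCollapse f z k) {i : Fin 2} {a b : P}
    (hab : a ≠ b) (hc : a ≤ b ∨ b ≤ a) (ha : f a = z i) (hb : f b = z i) :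
    IsFibrewiseDeformation (map f) (push hab hc) := by
  refine ⟨pushHomotopy hab hc, fun t x y hxy => ?_⟩
  rcases h.map_eq_map hxy with rfl | ⟨i', hx, hy⟩
  · rfl
  have key : ∀ x ∈ fibreOver f (z i'), map f (pushHomotopy hab hc (t, x)) = vertex (z i') := by
    refine fun x hx => mem_fibreOver_iff.1 fun p hp => ?_
    by_contra hne
    have hp0 : x.1 p = 0 := by_contra fun h0 => hne (hx p h0)
    rcases eq_or_ne i' i with rfl | hi
    · exact hp (pushFun_coord_eq_zero hab hc hp0 (fun e => hne (e ▸ hb)) t)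
    · have hz : z i ≠ z i' := fun e => hi (h.injective_base e.symm)
      have h0 : ∀ a, f a = z i → x.1 a = 0 := fun a ha =>
        by_contra fun h0 => hz (ha.symm.trans (hx a h0))
      refine hp (Eq.trans ?_ hp0)
      exact congrArg (fun x : ClassifyingSpace P => x.1 p)
        (pushFun_of_eq_zero hab hc (h0 a ha) (h0 b hb) t)
  rw [key x hx, key y hy]

/-- Induction on m, pushing `k i m` onto the next vertex. A point of the tail with weight on `k i m`
lies on that edge, since later vertices are incomparable to `k i m`, and so ends at the next vertex.
-/
theorem exists_deformation_to_tail (h : IsZigzagCollapse f z k) (i : Fin 2) (m : ℕ) (hm : m ≤ 4) :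
    ∃ g, IsFibrewiseDeformation (map f) g ∧ (∀ x, (∀ j, x.1 (k i j) = 0) → g x = x) ∧
      ∀ x ∈ fibreOver f (z i), ∀ p, (g x).1 p ≠ 0 → ∃ j : Fin 5, m ≤ j ∧ k i j = p := by
  induction m with
  | zero =>
    refine ⟨_, IsFibrewiseDeformation.refl _, fun x _ => rfl, fun x hx p hp => ?_⟩
    obtain ⟨j, hj⟩ := (h.fibre i p).1 (hx p hp)
    exact ⟨j, Nat.zero_le _, hj⟩
  | succ m ih =>
    obtain ⟨g, hg, hfix, htail⟩ := ih (by omega)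
    let j₀ : Fin 4 := ⟨m, by omega⟩
    have hab := (h.isZigzag i).castSucc_ne_succ j₀
    have hc := (h.isZigzag i).comparable j₀
    refine ⟨(push hab hc).comp g, (h.isFibrewiseDeformation_push hab hc (h.map_zigzag i _)
      (h.map_zigzag i _)).comp hg, fun x hx => ?_, fun x hx p hp => ?_⟩
    · rw [ContinuousMap.comp_apply, hfix x hx]
      exact pushFun_of_eq_zero hab hc (hx _) (hx _) 1
    · have ht := htail x hx
      rw [ContinuousMap.comp_apply] at hp
      by_cases hpb : p = k i j₀.succ
      · exact ⟨j₀.succ, le_rfl, hpb.symm⟩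
      by_cases ha : (g x).1 (k i j₀.castSucc) = 0
      · have hgp : (g x).1 p ≠ 0 := fun h0 => hp (pushFun_coord_eq_zero hab hc h0 hpb 1)
        obtain ⟨j, hj, rfl⟩ := ht p hgp
        refine ⟨j, lt_of_le_of_ne hj fun e => hgp ?_, rfl⟩
        have hj₀ : j = j₀.castSucc := Fin.ext e.symm
        rwa [hj₀]
      · have hsum : (g x).1 (k i j₀.castSucc) + (g x).1 (k i j₀.succ) = 1 := by
          classical
          rw [← Finset.sum_pair hab]
          refine (g x).sum_coord_of_subset _ fun p hp => ?_
          by_contra hgp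
          obtain ⟨j, hj, rfl⟩ := ht p hgp
          have hle : (j : ℕ) ≤ m + 1 := by
            rcases (g x).comparable ha hgp with hle | hle
            exacts [((h.isZigzag i).le_succ_of_le _ _ hle).2,
              ((h.isZigzag i).le_succ_of_le _ _ hle).1]
          refine hp ?_
          rcases hj.eq_or_lt with e | e
          · rw [show j = j₀.castSucc from Fin.ext e.symm]
            exact Finset.mem_insert_self _ _
          · rw [show j = j₀.succ from Fin.ext (le_antisymm hle e)]
            simp
        refine absurd ?_ hp
        rw [show push hab hc (g x) = vertex (k i j₀.succ) from
          pushFun_one_of_add_eq_one hab hc hsum, vertex_coord_of_ne hpb]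

theorem exists_deformation_to_vertex (h : IsZigzagCollapse f z k) (i : Fin 2) :
    ∃ g, IsFibrewiseDeformation (map f) g ∧ (∀ x, (∀ j, x.1 (k i j) = 0) → g x = x) ∧
      ∀ x ∈ fibreOver f (z i), g x = vertex (k i 4) := by
  obtain ⟨g, hg, hfix, htail⟩ := h.exists_deformation_to_tail i 4 le_rfl
  refine ⟨g, hg, hfix, fun x hx => eq_vertex_of_forall fun p hp => ?_⟩
  by_contra hne
  obtain ⟨j, hj, rfl⟩ := htail x hx p hne
  exact hp (congrArg _ (Fin.ext (le_antisymm (Nat.le_of_lt_succ j.2) hj)))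

theorem isHomotopyEquivalence (h : IsZigzagCollapse f z k) : IsHomotopyEquivalence (map f) := by
  obtain ⟨g₀, hg₀, hfix, hv₀⟩ := h.exists_deformation_to_vertex 0
  obtain ⟨g₁, hg₁, -, hv₁⟩ := h.exists_deformation_to_vertex 1
  refine (hg₁.comp hg₀).isHomotopyEquivalence h.isQuotientMap fun x y hxy => ?_
  rcases h.map_eq_map hxy with rfl | ⟨i, hx, hy⟩
  · rfl
  rw [ContinuousMap.comp_apply, ContinuousMap.comp_apply]
  rcases Fin.exists_fin_two.1 ⟨i, rfl⟩ with rfl | rfl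
  · rw [hv₀ x hx, hv₀ y hy]
  -- The contraction of the first arc does not move the second.
  · have key : ∀ x ∈ fibreOver f (z 1), g₀ x = x := fun x hx => hfix x fun j => by
      by_contra h0
      have := (h.map_zigzag 0 j).symm.trans (hx _ h0)
      exact zero_ne_one (h.injective_base this)
    rw [key x hx, key y hy, hv₁ x hx, hv₁ y hy]

theorem exists_homeomorph_collapseTwo (h : IsZigzagCollapse f z k) :
    ∃ e : CollapseTwo (fibreOver f (z 0)) (fibreOver f (z 1)) ≃ₜ ClassifyingSpace Q,
      ∀ x, e (Quot.mk _ x) = map f x := by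
  let r : CollapseTwo (fibreOver f (z 0)) (fibreOver f (z 1)) → ClassifyingSpace Q :=
    Quot.lift (map f) fun x y hxy => by
      rcases hxy with ⟨hx, hy⟩ | ⟨hx, hy⟩ <;>
      exact (mem_fibreOver_iff.1 hx).trans (mem_fibreOver_iff.1 hy).symm
  have hbij : Function.Bijective r := by
    constructor
    · rintro ⟨x⟩ ⟨y⟩ hxy
      rcases h.map_eq_map hxy with rfl | ⟨i, hx, hy⟩
      · rfl
      rcases Fin.exists_fin_two.1 ⟨i, rfl⟩ with rfl | rfl
      exacts [Quot.sound (Or.inl ⟨hx, hy⟩), Quot.sound (Or.inr ⟨hx, hy⟩)]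
    · intro y
      obtain ⟨x, hx⟩ := h.isQuotientMap.surjective y
      exact ⟨Quot.mk _ x, hx⟩
  refine ⟨(Equiv.ofBijective r hbij).toHomeomorph fun U => ?_, fun x => rfl⟩
  -- Both topologies are quotient topologies of |P|.
  rw [← h.isQuotientMap.isOpen_preimage, ← isQuotientMap_quot_mk.isOpen_preimage]
  rfl

end IsZigzagCollapse

end Collapse

end ClassifyingSpace

/-! ### The box complex of a subdivided graph -/

namespace LoopGraph

section BoxComplex

variable {V : Type*}

theorem fin_two_eq_or (i j : Fin 2) : j = i ∨ j = i + 1 := by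
  revert i j
  decide

theorem fin_two_succ_succ (i : Fin 2) : i + 1 + 1 = i := by
  revert i
  decide

theorem fin_two_succ_ne (i : Fin 2) : i + 1 ≠ i := by
  revert i
  decide

/-- The element of the box complex with `σ` in place `i` and `τ` in the other place. -/
def Box.ofPair (G : LoopGraph V) (i : Fin 2) (σ τ : Set V) (hσ : σ.Nonempty) (hτ : τ.Nonempty)
    (h : ∀ a ∈ σ, ∀ b ∈ τ, G.Adj a b) : Box G :=
  ⟨fun j => if j = i then σ else τ, fun j => by
      dsimp only
      split_ifs
      exacts [hσ, hτ], fun j l hjl a ha b hb => by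
      dsimp only at ha hb
      split_ifs at ha hb with hj hl hl
      · exact absurd (hj.trans hl.symm) hjl
      · exact h a ha b hb
      · exact G.symm (h b hb a ha)
      · exact absurd (((fin_two_eq_or i j).resolve_left hj).trans
          ((fin_two_eq_or i l).resolve_left hl).symm) hjl⟩

namespace Box

variable {W : Type*} {G : LoopGraph V} {H : LoopGraph W}

theorem ofPair_self {i : Fin 2} {σ τ : Set V} (hσ hτ h) : (ofPair G i σ τ hσ hτ h).1 i = σ := by
  simp [ofPair]

theorem ofPair_succ {i : Fin 2} {σ τ : Set V} (hσ hτ h) :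
    (ofPair G i σ τ hσ hτ h).1 (i + 1) = τ := by
  simp [ofPair]

theorem le_iff (i : Fin 2) {η η' : Box G} :
    η ≤ η' ↔ η.1 i ⊆ η'.1 i ∧ η.1 (i + 1) ⊆ η'.1 (i + 1) := by
  refine ⟨fun h => ⟨h i, h (i + 1)⟩, fun h j => ?_⟩
  rcases fin_two_eq_or i j with rfl | rfl
  exacts [h.1, h.2]

theorem eq_iff (i : Fin 2) {η η' : Box G} :
    η = η' ↔ η.1 i = η'.1 i ∧ η.1 (i + 1) = η'.1 (i + 1) := by
  refine ⟨fun h => h ▸ ⟨rfl, rfl⟩, fun h => Subtype.ext (funext fun j => ?_)⟩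
  rcases fin_two_eq_or i j with rfl | rfl
  exacts [h.1, h.2]

theorem adj (η : Box G) {i : Fin 2} {a b : V} (ha : a ∈ η.1 i) (hb : b ∈ η.1 (i + 1)) :
    G.Adj a b :=
  η.2.2 i (i + 1) (fin_two_succ_ne i).symm a ha b hb

theorem map_apply (g : Hom G H) (η : Box G) (i : Fin 2) : (Box.map g η).1 i = g '' η.1 i :=
  rfl

end Box

end BoxComplex

/-! ### Folding the path of G_e onto the edge e -/

section Subdivision

variable {V W : Type*}

/-- The local structure of the map that contracts a path `w', x, y, v'` in the opposite direction:
`x` is identified with `w'` and `y` with `v'`. -/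
structure IsPathFold (H : LoopGraph W) (r : W → V) (x y v' w' : W) : Prop where
  adj_left : ∀ u, H.Adj x u ↔ u = y ∨ u = v'
  adj_right : ∀ u, H.Adj y u ↔ u = x ∨ u = w'
  not_adj : ¬ H.Adj v' w'
  map_eq_left : ∀ u, r u = r w' ↔ u = x ∨ u = w'
  map_eq_right : ∀ u, r u = r v' ↔ u = y ∨ u = v'
  eq_of_map_eq : ∀ u u', r u = r u' → r u ≠ r w' → r u ≠ r v' → u = u'

namespace IsPathFold

variable {H : LoopGraph W} {r : W → V} {x y v' w' : W}

theorem swap (h : IsPathFold H r x y v' w') : IsPathFold H r y x w' v' :=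
  ⟨h.adj_right, h.adj_left, fun h' => h.not_adj (H.symm h'), h.map_eq_right, h.map_eq_left,
    fun u u' h1 h2 h3 => h.eq_of_map_eq u u' h1 h3 h2⟩

/-- The neighbours of y are x and w', those of x are y and v'; this bounds σ and τ. -/
theorem image_eq (h : IsPathFold H r x y v' w') {σ τ : Set W}
    (hadj : ∀ a ∈ σ, ∀ b ∈ τ, H.Adj a b) (hx : x ∈ σ) (hy : y ∈ τ) :
    r '' σ = {r w'} ∧ r '' τ = {r v'} := by
  constructor
  · refine Set.eq_singleton_iff_nonempty_unique_mem.2 ⟨⟨_, x, hx, rfl⟩, ?_⟩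
    rintro _ ⟨a, ha, rfl⟩
    exact (h.map_eq_left a).2 ((h.adj_right a).1 (H.symm (hadj a ha y hy)))
  · refine Set.eq_singleton_iff_nonempty_unique_mem.2 ⟨⟨_, y, hy, rfl⟩, ?_⟩
    rintro _ ⟨b, hb, rfl⟩
    exact (h.map_eq_right b).2 ((h.adj_left b).1 (hadj x hx b hb))

/-- If u fails to lie in σ', then one of σ, σ' contains x and the other w'. The few neighbours of x,
together with the non-adjacency of v' and w', then put y opposite x, and the smaller image is forced
to be the edge itself, which is excluded. -/
theorem mem_of_image_subset_left (h : IsPathFold H r x y v' w') {σ τ σ' τ' : Set W}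
    (hτ : τ.Nonempty) (hadj : ∀ a ∈ σ, ∀ b ∈ τ, H.Adj a b)
    (hadj' : ∀ a ∈ σ', ∀ b ∈ τ', H.Adj a b) (hσσ : r '' σ ⊆ r '' σ') (hττ : r '' τ ⊆ r '' τ')
    (hne : ¬ (r '' σ = {r w'} ∧ r '' τ = {r v'})) {u : W} (hu : u ∈ σ) (hr : r u = r w') :
    u ∈ σ' := by
  obtain ⟨u', hu', hru⟩ := hσσ ⟨u, hu, rfl⟩
  have hr' := hru.trans hr
  by_contra hnot
  obtain ⟨t, ht⟩ := hτ
  rcases (h.map_eq_left u).1 hr with rfl | rfl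
  · rcases (h.map_eq_left u').1 hr' with rfl | rfl
    · exact hnot hu'
    have hτv : ∀ b ∈ τ, r b = r v' := fun b hb =>
      (h.map_eq_right b).2 ((h.adj_left b).1 (hadj _ hu b hb))
    obtain ⟨t', ht', hrt⟩ := hττ ⟨t, ht, rfl⟩
    have hy : y ∈ τ' := by
      rcases (h.map_eq_right t').1 (hrt.trans (hτv t ht)) with rfl | rfl
      · exact ht'
      · exact absurd (H.symm (hadj' _ hu' _ ht')) h.not_adj
    refine hne ⟨Set.eq_singleton_iff_nonempty_unique_mem.2 ⟨⟨_, _, hu, rfl⟩, ?_⟩,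
      Set.eq_singleton_iff_nonempty_unique_mem.2 ⟨⟨_, t, ht, rfl⟩, ?_⟩⟩
    · intro q hq
      obtain ⟨a, ha, rfl⟩ := hσσ hq
      exact (h.map_eq_left a).2 ((h.adj_right a).1 (H.symm (hadj' a ha y hy)))
    · rintro _ ⟨b, hb, rfl⟩
      exact hτv b hb
  · rcases (h.map_eq_left u').1 hr' with rfl | rfl
    · have hτy : ∀ b ∈ τ, b = y := fun b hb => by
        obtain ⟨b', hb', hrb⟩ := hττ ⟨b, hb, rfl⟩
        have := (h.map_eq_right b').2 ((h.adj_left b').1 (hadj' _ hu' b' hb'))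
        rcases (h.map_eq_right b).1 (hrb.symm.trans this) with rfl | rfl
        · rfl
        · exact absurd (H.symm (hadj _ hu _ hb)) h.not_adj
      have hy : y ∈ τ := hτy t ht ▸ ht
      refine hne ⟨Set.eq_singleton_iff_nonempty_unique_mem.2 ⟨⟨_, _, hu, rfl⟩, ?_⟩,
        Set.eq_singleton_iff_nonempty_unique_mem.2 ⟨⟨_, t, ht, rfl⟩, ?_⟩⟩
      · rintro _ ⟨a, ha, rfl⟩
        exact (h.map_eq_left a).2 ((h.adj_right a).1 (H.symm (hadj a ha y hy)))
      · rintro _ ⟨b, hb, rfl⟩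
        exact (h.map_eq_right b).2 (Or.inl (hτy b hb))
    · exact hnot hu'

theorem subset_of_image_subset (h : IsPathFold H r x y v' w') {σ τ σ' τ' : Set W}
    (hτ : τ.Nonempty) (hadj : ∀ a ∈ σ, ∀ b ∈ τ, H.Adj a b)
    (hadj' : ∀ a ∈ σ', ∀ b ∈ τ', H.Adj a b) (hσσ : r '' σ ⊆ r '' σ') (hττ : r '' τ ⊆ r '' τ')
    (hne : ¬ (r '' σ = {r w'} ∧ r '' τ = {r v'})) (hne' : ¬ (r '' σ = {r v'} ∧ r '' τ = {r w'})) :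
    σ ⊆ σ' := by
  intro u hu
  by_cases hw : r u = r w'
  · exact h.mem_of_image_subset_left hτ hadj hadj' hσσ hττ hne hu hw
  by_cases hv : r u = r v'
  · exact h.swap.mem_of_image_subset_left hτ hadj hadj' hσσ hττ hne' hu hv
  obtain ⟨u', hu', hru⟩ := hσσ ⟨u, hu, rfl⟩
  rwa [h.eq_of_map_eq u u' hru.symm hw hv]

end IsPathFold

variable (G : LoopGraph V) {v w : V}

theorem retract_inl (hvw : G.Adj v w) (a : V) : G.retract v w hvw (Sum.inl a) = a :=
  rfl

theorem retract_zero (hvw : G.Adj v w) : G.retract v w hvw (Sum.inr 0) = w :=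
  rfl

theorem retract_one (hvw : G.Adj v w) : G.retract v w hvw (Sum.inr 1) = v :=
  rfl

theorem subdivide_adj_inl {a b : V} :
    (G.subdivide v w).Adj (Sum.inl a) (Sum.inl b) ↔ (G.deleteEdge v w).Adj a b := by
  simp [subdivide, Pair]

theorem subdivide_adj_zero (u : V ⊕ Fin 2) :
    (G.subdivide v w).Adj (Sum.inr 0) u ↔ u = Sum.inr 1 ∨ u = Sum.inl v := by
  simp [subdivide, Pair]

theorem subdivide_adj_one (u : V ⊕ Fin 2) :
    (G.subdivide v w).Adj (Sum.inr 1) u ↔ u = Sum.inr 0 ∨ u = Sum.inl w := by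
  simp [subdivide, Pair]

theorem isPathFold_retract (hvw : G.Adj v w) (hne : v ≠ w) :
    IsPathFold (G.subdivide v w) (G.retract v w hvw) (Sum.inr 0) (Sum.inr 1) (Sum.inl v)
      (Sum.inl w) where
  adj_left := G.subdivide_adj_zero
  adj_right := G.subdivide_adj_one
  not_adj h := (G.subdivide_adj_inl.1 h).2 (Or.inl ⟨rfl, rfl⟩)
  map_eq_left := by
    rintro (a | j)
    · simp [retract_inl]
    · fin_cases j <;> simp [retract_inl, retract_zero, retract_one, hne]
  map_eq_right := by
    rintro (a | j)
    · simp [retract_inl]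
    · fin_cases j <;> simp [retract_inl, retract_zero, retract_one, hne.symm]
  eq_of_map_eq := by
    have key : ∀ u, G.retract v w hvw u ≠ w → G.retract v w hvw u ≠ v →
        u = Sum.inl (G.retract v w hvw u) := by
      rintro (a | j) h1 h2
      · rfl
      · fin_cases j
        exacts [absurd rfl h1, absurd rfl h2]
    intro u u' h h1 h2
    rw [key u h1 h2, key u' (h ▸ h1) (h ▸ h2), h]

/-- The first components of the zigzag over the edge. -/
def zigzagFst (w : V) : Fin 5 → Set (V ⊕ Fin 2) :=
  ![{Sum.inr 0}, {Sum.inr 0}, {Sum.inr 0}, {Sum.inr 0, Sum.inl w}, {Sum.inl w}]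

/-- The second components of the zigzag over the edge. -/
def zigzagSnd (v : V) : Fin 5 → Set (V ⊕ Fin 2) :=
  ![{Sum.inl v}, {Sum.inr 1, Sum.inl v}, {Sum.inr 1}, {Sum.inr 1}, {Sum.inr 1}]

/-- The zigzag in `B(G_e)` over one of the two copies of the edge `e` in `B(G)`. -/
def zigzag (v w : V) (i : Fin 2) (j : Fin 5) : Box (G.subdivide v w) :=
  Box.ofPair _ i (zigzagFst w j) (zigzagSnd v j)
    (by fin_cases j <;> simp [zigzagFst]) (by fin_cases j <;> simp [zigzagSnd]) (by
      have h0 := G.subdivide_adj_zero (v := v) (w := w)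
      have h1 : ∀ u, (G.subdivide v w).Adj u (Sum.inr 1) ↔ u = Sum.inr 0 ∨ u = Sum.inl w :=
        fun u => ⟨fun h => (G.subdivide_adj_one u).1 (LoopGraph.symm _ h),
          fun h => LoopGraph.symm _ ((G.subdivide_adj_one u).2 h)⟩
      fin_cases j <;> simp [zigzagFst, zigzagSnd, h0, h1])

/-- One of the two copies of the edge `e` in `B(G)`. -/
def edgeVertex (hvw : G.Adj v w) (i : Fin 2) : Box G :=
  Box.ofPair G i {w} {v} (Set.singleton_nonempty _) (Set.singleton_nonempty _) (by
    rintro a rfl b rfl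
    exact G.symm hvw)

theorem map_eq_edgeVertex_iff (hvw : G.Adj v w) {i : Fin 2} {η : Box (G.subdivide v w)} :
    Box.map (G.retract v w hvw) η = G.edgeVertex hvw i ↔
      G.retract v w hvw '' η.1 i = {w} ∧ G.retract v w hvw '' η.1 (i + 1) = {v} := by
  rw [Box.eq_iff i, edgeVertex, Box.ofPair_self, Box.ofPair_succ, Box.map_apply, Box.map_apply]

theorem zigzag_le_iff {i : Fin 2} {j : Fin 5} {η : Box (G.subdivide v w)} :
    G.zigzag v w i j ≤ η ↔ zigzagFst w j ⊆ η.1 i ∧ zigzagSnd v j ⊆ η.1 (i + 1) := by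
  rw [Box.le_iff i, zigzag, Box.ofPair_self, Box.ofPair_succ]

/-- Indices 1 and 3 are the peaks. This reduces the zigzag axioms to `decide`. -/
theorem zigzag_le_zigzag_iff (i : Fin 2) (j l : Fin 5) :
    G.zigzag v w i j ≤ G.zigzag v w i l ↔
      j = l ∨ (l = 1 ∧ (j = 0 ∨ j = 2)) ∨ (l = 3 ∧ (j = 2 ∨ j = 4)) := by
  rw [zigzag_le_iff, zigzag, Box.ofPair_self, Box.ofPair_succ]
  fin_cases j <;> fin_cases l <;>
    simp [zigzagFst, zigzagSnd, Fin.ext_iff]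

theorem isZigzag_zigzag (i : Fin 2) : ClassifyingSpace.IsZigzag (G.zigzag v w i) where
  injective j l h := by
    have h1 := (G.zigzag_le_zigzag_iff i j l).1 h.le
    have h2 := (G.zigzag_le_zigzag_iff i l j).1 h.ge
    revert h1 h2
    clear h
    revert j l
    decide
  comparable j := by
    rw [zigzag_le_zigzag_iff, zigzag_le_zigzag_iff]
    revert j
    decide
  le_succ_of_le j l h := by
    have h1 := (G.zigzag_le_zigzag_iff i j l).1 h
    clear h
    revert h1
    revert j l
    decide

theorem map_retract_eq_edgeVertex (hvw : G.Adj v w) (hne : v ≠ w) {i : Fin 2}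
    {η : Box (G.subdivide v w)} (h0 : Sum.inr 0 ∈ η.1 i) (h1 : Sum.inr 1 ∈ η.1 (i + 1)) :
    Box.map (G.retract v w hvw) η = G.edgeVertex hvw i :=
  (G.map_eq_edgeVertex_iff hvw).2 <|
    (G.isPathFold_retract hvw hne).image_eq (fun _ ha _ hb => η.adj ha hb) h0 h1

/-- The sides are nonempty subsets of {0, w} and {1, v}. Of the nine pairs, the four with both w and
v are excluded because e was deleted. -/
theorem map_retract_eq_edgeVertex_iff (hvw : G.Adj v w) (hne : v ≠ w) {i : Fin 2}
    {η : Box (G.subdivide v w)} :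
    Box.map (G.retract v w hvw) η = G.edgeVertex hvw i ↔ ∃ j, G.zigzag v w i j = η := by
  have hfold := G.isPathFold_retract hvw hne
  constructor
  · intro h
    rw [map_eq_edgeVertex_iff] at h
    have hσ : η.1 i ⊆ {Sum.inr 0, Sum.inl w} := fun a ha =>
      (hfold.map_eq_left a).1 (h.1.subset ⟨a, ha, rfl⟩)
    have hτ : η.1 (i + 1) ⊆ {Sum.inr 1, Sum.inl v} := fun a ha =>
      (hfold.map_eq_right a).1 (h.2.subset ⟨a, ha, rfl⟩)
    have hnot : ¬ (Sum.inl w ∈ η.1 i ∧ Sum.inl v ∈ η.1 (i + 1)) := fun h =>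
      hfold.not_adj (LoopGraph.symm _ (η.adj h.1 h.2))
    have hj : ∀ j, zigzagFst w j = η.1 i → zigzagSnd v j = η.1 (i + 1) →
        ∃ j, G.zigzag v w i j = η := fun j h1 h2 =>
      ⟨j, (Box.eq_iff i).2 ⟨(Box.ofPair_self _ _ _).trans h1, (Box.ofPair_succ _ _ _).trans h2⟩⟩
    rcases Set.subset_pair_iff_eq.1 hσ with h1 | h1 | h1 | h1
    · exact absurd h1 (η.2.1 i).ne_empty
    · rcases Set.subset_pair_iff_eq.1 hτ with h2 | h2 | h2 | h2
      · exact absurd h2 (η.2.1 (i + 1)).ne_empty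
      exacts [hj 2 h1.symm h2.symm, hj 0 h1.symm h2.symm, hj 1 h1.symm h2.symm]
    all_goals
      rcases Set.subset_pair_iff_eq.1 hτ with h2 | h2 | h2 | h2
      · exact absurd h2 (η.2.1 (i + 1)).ne_empty
      rotate_left
      · exact absurd (by simp [h1, h2]) hnot
      · exact absurd (by simp [h1, h2]) hnot
    exacts [hj 4 h1.symm h2.symm, hj 3 h1.symm h2.symm]
  · rintro ⟨j, rfl⟩
    rw [map_eq_edgeVertex_iff, zigzag, Box.ofPair_self, Box.ofPair_succ]
    fin_cases j <;>
      simp [zigzagFst, zigzagSnd, Set.image_pair, retract_inl, retract_zero, retract_one]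

theorem surjective_map_retract (hvw : G.Adj v w) (hne : v ≠ w)
    (hloop : ¬ (G.Adj v v ∧ G.Adj w w))
    (hpath : ¬ ∃ φ : Hom (path 3) (G.deleteEdge v w), φ 0 = v ∧ φ 3 = w) :
    Function.Surjective (Box.map (G.retract v w hvw)) := by
  intro q
  by_cases hq : ∃ i, w ∈ q.1 i ∧ v ∈ q.1 (i + 1)
  · obtain ⟨i, hw, hv⟩ := hq
    -- Otherwise v, a, b, w is a path in G ∖ e. Its middle edge could only be e with a = v and b =
    -- w, which would make both v and w looped.
    have hcases : (∀ a ∈ q.1 i, a = w) ∨ ∀ b ∈ q.1 (i + 1), b = v := by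
      by_contra! hab
      obtain ⟨⟨a, ha, haw⟩, b, hb, hbv⟩ := hab
      have h1 : (G.deleteEdge v w).Adj v a :=
        ⟨G.symm (q.adj ha hv), by rintro (⟨-, h⟩ | ⟨h, -⟩); exacts [haw h, hne h]⟩
      have h2 : (G.deleteEdge v w).Adj a b := by
        refine ⟨q.adj ha hb, ?_⟩
        rintro (⟨rfl, rfl⟩ | ⟨h, -⟩)
        exacts [hloop ⟨q.adj ha hv, q.adj hw hb⟩, haw h]
      have h3 : (G.deleteEdge v w).Adj b w :=
        ⟨G.symm (q.adj hw hb), by rintro (⟨h, -⟩ | ⟨-, h⟩); exacts [hbv h, hne h.symm]⟩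
      refine hpath ⟨⟨![v, a, b, w], fun {c d} hcd => ?_⟩, rfl, rfl⟩
      have h1' := (G.deleteEdge v w).symm h1
      have h2' := (G.deleteEdge v w).symm h2
      have h3' := (G.deleteEdge v w).symm h3
      revert hcd
      fin_cases c <;> fin_cases d <;> simp [path, h1, h2, h3, h1', h2', h3']
    rcases hcases with hσ | hτ
    -- With w alone on its side, replacing v by the new vertex 1 gives a lift.
    · refine ⟨Box.ofPair _ i {Sum.inl w} (insert (Sum.inr 1) (Sum.inl '' (q.1 (i + 1) \ {v})))
        (Set.singleton_nonempty _) (Set.insert_nonempty _ _) ?_, (Box.eq_iff i).2 ⟨?_, ?_⟩⟩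
      · rintro a rfl b (rfl | ⟨b, ⟨hb, hbv⟩, rfl⟩)
        · exact LoopGraph.symm _ ((G.subdivide_adj_one _).2 (Or.inr rfl))
        · refine G.subdivide_adj_inl.2 ⟨q.adj hw hb, ?_⟩
          rintro (⟨h, -⟩ | ⟨-, h⟩)
          exacts [hne h.symm, hbv h]
      · rw [Box.map_apply, Box.ofPair_self, Set.image_singleton, retract_inl]
        exact (Set.eq_singleton_iff_unique_mem.2 ⟨hw, hσ⟩).symm
      · rw [Box.map_apply, Box.ofPair_succ, Set.image_insert_eq, Set.image_image, retract_one]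
        simp only [retract_inl, Set.image_id', Set.insert_sdiff_singleton]
        exact Set.insert_eq_of_mem hv
    · refine ⟨Box.ofPair _ i (insert (Sum.inr 0) (Sum.inl '' (q.1 i \ {w}))) {Sum.inl v}
        (Set.insert_nonempty _ _) (Set.singleton_nonempty _) ?_, (Box.eq_iff i).2 ⟨?_, ?_⟩⟩
      · rintro a (rfl | ⟨a, ⟨ha, haw⟩, rfl⟩) b rfl
        · exact (G.subdivide_adj_zero _).2 (Or.inr rfl)
        · refine G.subdivide_adj_inl.2 ⟨q.adj ha hv, ?_⟩
          rintro (⟨-, h⟩ | ⟨h, -⟩)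
          exacts [hne h, haw h]
      · rw [Box.map_apply, Box.ofPair_self, Set.image_insert_eq, Set.image_image, retract_zero]
        simp only [retract_inl, Set.image_id', Set.insert_sdiff_singleton]
        exact Set.insert_eq_of_mem hw
      · rw [Box.map_apply, Box.ofPair_succ, Set.image_singleton, retract_inl]
        exact (Set.eq_singleton_iff_unique_mem.2 ⟨hv, hτ⟩).symm
  · push Not at hq
    refine ⟨⟨fun i => Sum.inl '' q.1 i, fun i => (q.2.1 i).image _, ?_⟩, ?_⟩
    · rintro i j hij _ ⟨a, ha, rfl⟩ _ ⟨b, hb, rfl⟩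
      refine G.subdivide_adj_inl.2 ⟨q.2.2 i j hij a ha b hb, ?_⟩
      have hji : j = i + 1 := (fin_two_eq_or i j).resolve_left fun h => hij h.symm
      have hij' : i = j + 1 := (fin_two_eq_or j i).resolve_left hij
      rintro (⟨rfl, rfl⟩ | ⟨rfl, rfl⟩)
      · exact hq j hb (hij' ▸ ha)
      · exact hq i ha (hji ▸ hb)
    · refine Subtype.ext (funext fun i => ?_)
      rw [Box.map_apply, Set.image_image]
      simp only [retract_inl, Set.image_id']

theorem isZigzagCollapse_map_retract (hvw : G.Adj v w)
    (hloop : ¬ (G.Adj v v ∧ G.Adj w w))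
    (hpath : ¬ ∃ φ : Hom (path 3) (G.deleteEdge v w), φ 0 = v ∧ φ 3 = w) :
    ClassifyingSpace.IsZigzagCollapse (Box.map (G.retract v w hvw)) (G.edgeVertex hvw)
      (G.zigzag v w) := by
  have hne : v ≠ w := by
    rintro rfl
    exact hloop ⟨hvw, hvw⟩
  have hfold := G.isPathFold_retract hvw hne
  refine ⟨G.surjective_map_retract hvw hne hloop hpath, fun i j hij => ?_, G.isZigzag_zigzag,
    fun i p => G.map_retract_eq_edgeVertex_iff hvw hne, fun i q hq => ?_,
    fun p p' hle hp i => ?_, fun i p hle hp => ?_, fun i p hp h => ?_, fun i j p hle hp => ?_⟩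
  · by_contra hne'
    have hj : j = i + 1 := (fin_two_eq_or i j).resolve_left fun h => hne' h.symm
    have := ((Box.eq_iff i).1 hij).2
    rw [edgeVertex, edgeVertex, Box.ofPair_succ, ← hj, Box.ofPair_self] at this
    exact hne (Set.singleton_injective this)
  · have h := (Box.le_iff i).1 hq
    rw [edgeVertex, Box.ofPair_self, Box.ofPair_succ] at h
    refine (Box.eq_iff i).2 ?_
    rw [edgeVertex, Box.ofPair_self, Box.ofPair_succ]
    exact ⟨(q.2.1 i).subset_singleton_iff.1 h.1, (q.2.1 _).subset_singleton_iff.1 h.2⟩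
  · have h := (Box.le_iff i).1 hle
    refine hfold.subset_of_image_subset (p.2.1 (i + 1)) (fun _ ha _ hb => p.adj ha hb)
      (fun _ ha _ hb => p'.adj ha hb) h.1 h.2
      (fun h => hp i ((G.map_eq_edgeVertex_iff hvw).2 h))
      fun h => hp (i + 1) ((G.map_eq_edgeVertex_iff hvw).2 ⟨h.2, ?_⟩)
    rw [fin_two_succ_succ]
    exact h.1
  · have h := (Box.le_iff i).1 hle
    rw [edgeVertex, Box.ofPair_self, Box.ofPair_succ, Set.singleton_subset_iff,
      Set.singleton_subset_iff] at h
    obtain ⟨⟨a, ha, hra⟩, b, hb, hrb⟩ := h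
    -- Over (w, v) lie (0, 1), which forces the fibre over the edge; (0, v) and (w, 1), the two
    -- ends; and (w, v), which is not adjacent.
    rcases (hfold.map_eq_left a).1 hra with rfl | rfl <;>
      rcases (hfold.map_eq_right b).1 hrb with rfl | rfl
    · exact absurd (G.map_retract_eq_edgeVertex hvw hne ha hb) hp
    · exact Or.inl (G.zigzag_le_iff.2
        ⟨Set.singleton_subset_iff.2 ha, Set.singleton_subset_iff.2 hb⟩)
    · exact Or.inr (G.zigzag_le_iff.2
        ⟨Set.singleton_subset_iff.2 ha, Set.singleton_subset_iff.2 hb⟩)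
    · exact absurd (LoopGraph.symm _ (p.adj ha hb)) hfold.not_adj
  · have h0 := (G.zigzag_le_iff.1 h.1).1
    have h4 := (G.zigzag_le_iff.1 h.2).2
    exact hp (G.map_retract_eq_edgeVertex hvw hne (h0 (Set.mem_singleton _))
      (h4 (Set.mem_singleton _)))
  · have h := G.zigzag_le_iff.1 hle
    by_contra! hj
    -- The three inner elements of the zigzag contain both new vertices, 0 and 1.
    refine hp (G.map_retract_eq_edgeVertex hvw hne (h.1 ?_) (h.2 ?_))
    all_goals
      revert hj
      fin_cases j <;> simp [zigzagFst, zigzagSnd]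

end Subdivision

end LoopGraph

theorem proposition3p2 {V : Type*} (G : LoopGraph V) (v w : V) (hvw : G.Adj v w)
    (hloop : ¬ (G.Adj v v ∧ G.Adj w w))
    (hpath : ¬ ∃ φ : LoopGraph.Hom (LoopGraph.path 3) (G.deleteEdge v w), φ 0 = v ∧ φ 3 = w) :
    IsHomotopyEquivalence
      (ClassifyingSpace.map (LoopGraph.Box.map (G.retract v w hvw))) ∧
    ∃ I J : Set (ClassifyingSpace (LoopGraph.Box (G.subdivide v w))),
      Disjoint I J ∧ Nonempty (I ≃ₜ unitInterval) ∧ Nonempty (J ≃ₜ unitInterval) ∧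
      ∃ h : CollapseTwo I J ≃ₜ ClassifyingSpace (LoopGraph.Box G),
        ∀ x, h (Quot.mk _ x) =
          ClassifyingSpace.map (LoopGraph.Box.map (G.retract v w hvw)) x := by
  have h := G.isZigzagCollapse_map_retract hvw hloop hpath
  exact ⟨h.isHomotopyEquivalence, _, _, h.disjoint_fibreOver zero_ne_one,
    h.nonempty_homeomorph_fibreOver 0, h.nonempty_homeomorph_fibreOver 1,
    h.exists_homeomorph_collapseTwo⟩
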